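/- Let $\mathbb T=\mathbb R/2\pi\mathbb Z$ with arc length distance $d$ and uniform probability measure $\lambda$, and let $p\ge 1$. Then there is a constant $\sigma(p)\in(0,1/2)$ depending only on $p$, and for every $A>0$ a constant $C(A,p)>0$ depending only on $A$ and $p$, such that the following holds. Let $a\in(0,1]$ and let $\nu$ be a probability measure on $\mathbb T$ that has a density, still denoted $\nu$, with respect to $\lambda$ satisfying $|\nu(y)-\nu(x)|\le A\,d(x,y)^a$ for all $x,y\in\mathbb T$. Put $$U_p(x)=\int d(x,y)^p\,\nu(dy),\qquad \mu_\beta(dx)=\frac{e^{-\beta U_p(x)}\lambda(dx)}{\int e^{-\beta U_p}\,d\lambda},\qquad a(p)=\begin{cases}\min(a,p-1)&\text{if }1<p<2,\\ a&\text{if } p=1\text{ or }p\ge 2.\end{cases}$$ For $\alpha>0$ and $\beta\geq 0$ let $L_{\alpha,\beta}$ be the operator, with domain $C^2(\mathbb T)$ in $L^2(\mu_\beta)$, $$L_{\alpha,\beta}f(x)=\tfrac12 f''(x)+\frac1\alpha\int \Big(f\big(\gamma(x,y,\tfrac p2\beta\alpha\, d(x,y)^{p-1})\big)-f(x)\Big)\,\nu(dy),$$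 where $t\mapsto\gamma(x,y,t)$ is the minimal unit speed geodesic with $\gamma(x,y,0)=x$ leading from $x$ to $y$ (the anti-clockwise one if $y=x+\pi$), and let $L^*_{\alpha,\beta}$ be its adjoint in $L^2(\mu_\beta)$. Then for all $\alpha>0$ and $\beta>1$ with $\alpha\beta^2<\sigma(p)$, the constant function $\mathbb 1$ belongs to the domain of $L^*_{\alpha,\beta}$ and $$\sqrt{\mu_\beta\big[(L^*_{\alpha,\beta}\mathbb 1)^2\big]}\le C(A,p)\,\alpha^{a(p)}\,\beta^4 .$$ -/

import Mathlib

open MeasureTheory Set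

namespace CircleMeans

noncomputable section

/-- The circle `ℝ / 2πℤ`. Its distance is the arc length distance `d`. -/
abbrev Torus : Type := AddCircle (2 * Real.pi)

instance torusFact : Fact (0 < 2 * Real.pi) := ⟨Real.two_pi_pos⟩

/-- The Riemannian (uniform) probability measure `λ` on the circle. -/
abbrev unif : Measure Torus := AddCircle.haarAddCircle

/-- `ν` has a density with respect to `λ` which satisfies
`|ν(y) - ν(x)| ≤ A d(x,y)^a` for all `x, y`. -/
def HasHolderDensity (ν : Measure Torus) (a A : ℝ) : Prop :=
  ∃ n : Torus → ℝ, (∀ x, 0 ≤ n x) ∧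
    (∀ x y, |n y - n x| ≤ A * dist x y ^ a) ∧
    ν = unif.withDensity (fun x => ENNReal.ofReal (n x))

/-- The potential `U_p(x) = ∫ d(x,y)^p ν(dy)`. -/
def potential (p : ℝ) (ν : Measure Torus) (x : Torus) : ℝ :=
  ∫ y, dist x y ^ p ∂ν

/-- The Gibbs measure `μ_β(dx) = exp(-β U_p(x)) λ(dx) / Z_β`. -/
def gibbs (p β : ℝ) (ν : Measure Torus) : Measure Torus :=
  unif.tilted (fun x => -β * potential p ν x)

/-- The representative in `(-π, π]` of a point of the circle. -/
def rep (z : Torus) : ℝ := (AddCircle.equivIoc (2 * Real.pi) (-Real.pi) z : ℝ)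

/-- The minimal geodesic with unit speed which starts at `x` and leads to `y`, at time `t`.
If `y = x + π`, the anti-clockwise one is taken. If `y = x`, it is constant. -/
def geod (x y : Torus) (t : ℝ) : Torus :=
  x + (((SignType.sign (rep (y - x)) : ℝ) * t : ℝ) : Torus)

/-- The second derivative `∂²f` of a function on the circle. -/
def secondDeriv (f : Torus → ℝ) (x : Torus) : ℝ :=
  iteratedDeriv 2 (fun t : ℝ => f (x + (t : Torus))) 0

/-- The exponent `a(p)`. -/
def expo (a p : ℝ) : ℝ := if 1 < p ∧ p < 2 then min a (p - 1) else a

/-- The generator of the algorithm as an operator on functions: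
`L f(x) = ∂²f(x)/2 + (1/α) ∫ (f(γ(x, y, (p/2) β α d(x,y)^(p-1))) - f(x)) ν(dy)`. -/
def genFun (p α β : ℝ) (ν : Measure Torus) (f : Torus → ℝ) (x : Torus) : ℝ :=
  1 / 2 * secondDeriv f x +
    1 / α * ∫ y, (f (geod x y (p / 2 * β * α * dist x y ^ (p - 1))) - f x) ∂ν

/-- The algebra of functions of class `C²` on the circle. -/
def C2 : Subalgebra ℝ C(Torus, ℝ) where
  carrier := {f | ContDiff ℝ 2 (fun t : ℝ => f (t : Torus))}
  mul_mem' {f g} hf hg := by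
    simpa using ContDiff.mul (mem_ofPred.mp hf) (mem_ofPred.mp hg)
  add_mem' {f g} hf hg := by
    simpa using ContDiff.add (mem_ofPred.mp hf) (mem_ofPred.mp hg)
  algebraMap_mem' r := by
    simpa using (contDiff_const : ContDiff ℝ 2 (fun _ : ℝ => r))

theorem contDiff_shift (f : C2) (x : Torus) :
    ContDiff ℝ 2 (fun t : ℝ => (f : C(Torus, ℝ)) (x + (t : Torus))) := by
  induction x using QuotientAddGroup.induction_on with
  | H u =>
    have h : ContDiff ℝ 2 (fun t : ℝ => (f : C(Torus, ℝ)) (t : Torus)) := f.2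
    have := h.comp (contDiff_const (c := u) |>.add contDiff_id)
    simpa [Function.comp_def] using this

theorem secondDeriv_coe (f : Torus → ℝ) (u : ℝ) :
    secondDeriv f (u : Torus) = iteratedDeriv 2 (fun t : ℝ => f (t : Torus)) u := by
  have := iteratedDeriv_comp_const_add 2 (fun t : ℝ => f (t : Torus)) u
  have h2 := congrFun this 0
  simpa [secondDeriv] using h2

theorem continuous_secondDeriv (f : C2) : Continuous (secondDeriv (f : C(Torus, ℝ))) := by
  have h : ContDiff ℝ 2 (fun t : ℝ => (f : C(Torus, ℝ)) (t : Torus)) := f.2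
  have h2 := h.continuous_iteratedDeriv 2 le_rfl
  refine (QuotientAddGroup.isQuotientMap_mk (N := AddSubgroup.zmultiples (2 * Real.pi))
    ).continuous_iff.2 ?_
  refine h2.congr fun u => ?_
  exact (secondDeriv_coe _ u).symm

theorem measurable_rep : Measurable rep :=
  measurable_subtype_coe.comp (AddCircle.measurableEquivIoc (2 * Real.pi) (-Real.pi)).measurable

theorem measurable_geod {α : Type*} [MeasurableSpace α] {x y : α → Torus} {t : α → ℝ}
    (hx : Measurable x) (hy : Measurable y) (ht : Measurable t) :
    Measurable (fun w => geod (x w) (y w) (t w)) := by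
  have hs : Measurable (fun r : ℝ => ((SignType.sign r : SignType) : ℝ)) := by
    have h : (fun r : ℝ => ((SignType.sign r : SignType) : ℝ)) =
        fun r => if 0 < r then 1 else if r < 0 then -1 else 0 := by
      ext r
      rw [sign_apply]
      split_ifs <;> simp
    rw [h]
    exact Measurable.ite measurableSet_Ioi measurable_const
      (Measurable.ite measurableSet_Iio measurable_const measurable_const)
  refine hx.add (AddCircle.measurable_mk'.comp ?_)
  exact (hs.comp (measurable_rep.comp (hy.sub hx))).mul ht

theorem measurable_jump (p c : ℝ) (f : C(Torus, ℝ)) :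
    Measurable (fun w : Torus × Torus =>
      f (geod w.1 w.2 (c * dist w.1 w.2 ^ (p - 1))) - f w.1) := by
  refine (f.continuous.measurable.comp (measurable_geod measurable_fst measurable_snd
    (measurable_const.mul ?_))).sub (f.continuous.measurable.comp measurable_fst)
  exact (measurable_fst.dist measurable_snd).pow_const _

theorem norm_jump_le (f : C(Torus, ℝ)) (x y : Torus) : ‖f x - f y‖ ≤ 2 * ‖f‖ := by
  calc _ ≤ ‖f x‖ + ‖f y‖ := norm_sub_le _ _
    _ ≤ ‖f‖ + ‖f‖ := add_le_add (f.norm_coe_le_norm x) (f.norm_coe_le_norm y)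
    _ = _ := by ring

theorem genFun_smul (p α β : ℝ) (ν : Measure Torus) (c : ℝ) (f : C2) (x : Torus) :
    genFun p α β ν ((c • f : C2) : C(Torus, ℝ)) x = c * genFun p α β ν (f : C(Torus, ℝ)) x := by
  have h1 : secondDeriv ((c • f : C2) : C(Torus, ℝ)) x = c * secondDeriv (f : C(Torus, ℝ)) x := by
    simp only [secondDeriv]
    exact iteratedDeriv_const_mul (n := 2) (x := 0) c (contDiff_shift f x).contDiffAt
  simp only [genFun]
  rw [h1]
  have h3 : ∫ y, (((c • f : C2) : C(Torus, ℝ)) (geod x y (p / 2 * β * α * dist x y ^ (p - 1)))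
      - ((c • f : C2) : C(Torus, ℝ)) x) ∂ν = c * ∫ y, ((f : C(Torus, ℝ))
        (geod x y (p / 2 * β * α * dist x y ^ (p - 1))) - (f : C(Torus, ℝ)) x) ∂ν := by
    rw [← integral_const_mul]
    refine integral_congr_ae (Filter.Eventually.of_forall fun y => ?_)
    simp only [Subalgebra.coe_smul, ContinuousMap.smul_apply, smul_eq_mul]
    ring
  rw [h3]
  ring

section measures

variable (p α β : ℝ) (ν : Measure Torus) [IsProbabilityMeasure ν]

theorem integrable_jump (c : ℝ) (f : C(Torus, ℝ)) (x : Torus) :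
    Integrable (fun y => f (geod x y (c * dist x y ^ (p - 1))) - f x) ν :=
  Integrable.of_bound
    ((measurable_jump p c f).comp measurable_prodMk_left).aestronglyMeasurable (2 * ‖f‖)
    (Filter.Eventually.of_forall fun _ => norm_jump_le f _ _)

theorem measurable_genFun (f : C2) : Measurable (genFun p α β ν (f : C(Torus, ℝ))) := by
  refine ((continuous_secondDeriv f).measurable.const_mul _).add (Measurable.const_mul ?_ _)
  exact ((measurable_jump p (p / 2 * β * α) f).stronglyMeasurable.integral_prod_right').measurable

theorem exists_genFun_bound (f : C2) : ∃ K, ∀ x, ‖genFun p α β ν (f : C(Torus, ℝ)) x‖ ≤ K := by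
  let g : C(Torus, ℝ) := ⟨_, continuous_secondDeriv f⟩
  refine ⟨‖(1 / 2 : ℝ)‖ * ‖g‖ + ‖1 / α‖ * (2 * ‖(f : C(Torus, ℝ))‖), fun x => ?_⟩
  refine (norm_add_le _ _).trans (add_le_add ?_ ?_)
  · rw [norm_mul]
    exact mul_le_mul_of_nonneg_left (g.norm_coe_le_norm x) (norm_nonneg _)
  · rw [norm_mul]
    refine mul_le_mul_of_nonneg_left ?_ (norm_nonneg _)
    have := norm_integral_le_of_norm_le_const (μ := ν) (C := 2 * ‖(f : C(Torus, ℝ))‖)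
      (f := fun y => (f : C(Torus, ℝ)) (geod x y (p / 2 * β * α * dist x y ^ (p - 1)))
        - (f : C(Torus, ℝ)) x)
      (Filter.Eventually.of_forall fun _ => norm_jump_le _ _ _)
    simpa using this

theorem memLp_genFun (μ : Measure Torus) [IsFiniteMeasure μ] (f : C2) :
    MemLp (genFun p α β ν (f : C(Torus, ℝ))) 2 μ := by
  obtain ⟨K, hK⟩ := exists_genFun_bound p α β ν f
  exact MemLp.of_bound (measurable_genFun p α β ν f).aestronglyMeasurable K
    (Filter.Eventually.of_forall hK)

theorem genFun_add (f g : C2) (x : Torus) :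
    genFun p α β ν ((f + g : C2) : C(Torus, ℝ)) x =
      genFun p α β ν (f : C(Torus, ℝ)) x + genFun p α β ν (g : C(Torus, ℝ)) x := by
  have h1 : secondDeriv ((f + g : C2) : C(Torus, ℝ)) x =
      secondDeriv (f : C(Torus, ℝ)) x + secondDeriv (g : C(Torus, ℝ)) x := by
    simp only [secondDeriv]
    rw [← iteratedDeriv_add (contDiff_shift f x).contDiffAt (contDiff_shift g x).contDiffAt]
    rfl
  simp only [genFun]
  rw [h1]
  have h2 := integral_add (integrable_jump p ν (p / 2 * β * α) (f : C(Torus, ℝ)) x)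
    (integrable_jump p ν (p / 2 * β * α) (g : C(Torus, ℝ)) x)
  have h3 : ∫ y, (((f + g : C2) : C(Torus, ℝ)) (geod x y (p / 2 * β * α * dist x y ^ (p - 1)))
      - ((f + g : C2) : C(Torus, ℝ)) x) ∂ν =
      ∫ y, ((f : C(Torus, ℝ)) (geod x y (p / 2 * β * α * dist x y ^ (p - 1)))
        - (f : C(Torus, ℝ)) x) ∂ν +
      ∫ y, ((g : C(Torus, ℝ)) (geod x y (p / 2 * β * α * dist x y ^ (p - 1)))
        - (g : C(Torus, ℝ)) x) ∂ν := by
    rw [← h2]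
    refine integral_congr_ae (Filter.Eventually.of_forall fun y => ?_)
    simp only [Subalgebra.coe_add, ContinuousMap.add_apply]
    ring
  rw [h3]
  ring

theorem integrable_exp_potential {β : ℝ} (hβ : 0 ≤ β) :
    Integrable (fun x => Real.exp (-β * potential p ν x)) unif := by
  have hm : Measurable (potential p ν) := by
    have : Measurable (fun w : Torus × Torus => dist w.1 w.2 ^ p) :=
      (measurable_fst.dist measurable_snd).pow_const _
    exact this.stronglyMeasurable.integral_prod_right'.measurable
  refine Integrable.of_bound (hm.const_mul _).exp.aestronglyMeasurable 1
    (Filter.Eventually.of_forall fun x => ?_)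
  rw [Real.norm_eq_abs, Real.abs_exp, Real.exp_le_one_iff]
  have : 0 ≤ potential p ν x := integral_nonneg fun y => Real.rpow_nonneg dist_nonneg _
  nlinarith

instance isFiniteMeasure_gibbs : IsFiniteMeasure (gibbs p β ν) := by
  by_cases h : Integrable (fun x => Real.exp (-β * potential p ν x)) unif
  · have := isProbabilityMeasure_tilted h
    exact inferInstanceAs (IsFiniteMeasure (unif.tilted _))
  · rw [gibbs, tilted_of_not_integrable h]
    infer_instance

theorem isProbabilityMeasure_gibbs {β : ℝ} (hβ : 0 ≤ β) :
    IsProbabilityMeasure (gibbs p β ν) :=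
  isProbabilityMeasure_tilted (integrable_exp_potential p ν hβ)

/-- The class in `L²(μ_β)` of a function of class `C²`. -/
def toL2 : C2 →ₗ[ℝ] Lp ℝ 2 (gibbs p β ν) :=
  (ContinuousMap.toLp (E := ℝ) 2 (gibbs p β ν) ℝ).toLinearMap ∘ₗ C2.val.toLinearMap

theorem toL2_injective {β : ℝ} (hβ : 0 ≤ β) : Function.Injective (toL2 p β ν) := by
  have : (gibbs p β ν).IsOpenPosMeasure :=
    (absolutelyContinuous_tilted (integrable_exp_potential p ν hβ)).isOpenPosMeasure
  exact (ContinuousMap.toLp_injective (𝕜 := ℝ) (p := 2) (gibbs p β ν)).comp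
    Subtype.val_injective

/-- The class in `L²(μ_β)` of `L f`, for `f` of class `C²`. -/
def genL2 : C2 →ₗ[ℝ] Lp ℝ 2 (gibbs p β ν) where
  toFun f := (memLp_genFun p α β ν (gibbs p β ν) f).toLp _
  map_add' f g := by
    rw [← MemLp.toLp_add]
    exact MemLp.toLp_congr _ _ (Filter.Eventually.of_forall fun x => genFun_add p α β ν f g x)
  map_smul' c f := by
    rw [RingHom.id_apply, ← MemLp.toLp_const_smul]
    exact MemLp.toLp_congr _ _ (Filter.Eventually.of_forall fun x => genFun_smul p α β ν c f x)

/-- The generator `L_{α,β}` as an unbounded operator on `L²(μ_β)`, with domain `C²(𝕋)`. -/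
def generator {β : ℝ} (hβ : 0 ≤ β) : Lp ℝ 2 (gibbs p β ν) →ₗ.[ℝ] Lp ℝ 2 (gibbs p β ν) where
  domain := LinearMap.range (toL2 p β ν)
  toFun := genL2 p α β ν ∘ₗ
    (LinearEquiv.ofInjective (toL2 p β ν) (toL2_injective p ν hβ)).symm.toLinearMap

/-- The operator sends the class of `f` to the class of `L f`. -/
theorem generator_apply {β : ℝ} (hβ : 0 ≤ β) (f : C2) :
    generator p α ν hβ ⟨toL2 p β ν f, LinearMap.mem_range_self _ f⟩ = genL2 p α β ν f := by
  change genL2 p α β ν ((LinearEquiv.ofInjective (toL2 p β ν) (toL2_injective p ν hβ)).symm _) = _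
  congr 1
  exact (LinearEquiv.ofInjective (toL2 p β ν) (toL2_injective p ν hβ)).symm_apply_apply f

/-- The constant function `1` in `L²(μ_β)`. -/
def oneL2 : Lp ℝ 2 (gibbs p β ν) := toL2 p β ν 1

theorem dense_C2 : Dense (C2 : Set C(Torus, ℝ)) := by
  have hsep : C2.SeparatesPoints := by
    have hc : ContDiff ℝ 2 (fun t : ℝ => Real.cos t) := Real.contDiff_cos
    have hs : ContDiff ℝ 2 (fun t : ℝ => Real.sin t) := Real.contDiff_sin
    intro x y hxy
    by_contra hne
    push Not at hne
    refine hxy ?_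
    let c : C(Torus, ℝ) := ⟨Real.cos_periodic.lift, continuous_coinduced_dom.2 Real.continuous_cos⟩
    let s : C(Torus, ℝ) := ⟨Real.sin_periodic.lift, continuous_coinduced_dom.2 Real.continuous_sin⟩
    have h1 := hne c ⟨c, hc, rfl⟩
    have h2 := hne s ⟨s, hs, rfl⟩
    induction x using QuotientAddGroup.induction_on with
    | H u =>
      induction y using QuotientAddGroup.induction_on with
      | H v =>
        exact Real.Angle.cos_sin_inj h1 h2
  have := ContinuousMap.subalgebra_topologicalClosure_eq_top_of_separatesPoints C2 hsep
  rw [dense_iff_closure_eq, ← Subalgebra.topologicalClosure_coe, this]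
  rfl

/-- The generator is densely defined, so that its adjoint is meaningful. -/
theorem dense_generator_domain {β : ℝ} (hβ : 0 ≤ β) :
    Dense ((generator p α ν hβ).domain : Set (Lp ℝ 2 (gibbs p β ν))) := by
  have h1 := (ContinuousMap.toLp_denseRange ℝ (gibbs p β ν) ℝ (p := 2) (by simp))
  have h2 := h1.dense_image (ContinuousMap.toLp (E := ℝ) 2 (gibbs p β ν) ℝ).continuous dense_C2
  refine h2.mono ?_
  rintro _ ⟨f, hf, rfl⟩
  exact ⟨⟨f, hf⟩, rfl⟩

end measures

end

end CircleMeans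


/-!
A bounded function `h` with `∫ h f dμ_β = ∫ L f dμ_β` for every `f` is `L* 1`. Integrating by parts
in the diffusion and changing variables in the jumps, `h = e^{βU} L'(e^{-βU})`, where `L'` is the
formal adjoint of `L` in `L²(λ)`. The targets of the jumps lie on either side of the starting
point, at arc length `θ ∈ (0, π)`; the jump lengths are proportional to `θ^{p-1}`, and `U'` is the
difference of the integrals of `p θ^{p-1}` against the densities of the targets on the two sides.
Expanded to first order in their length, the jumps therefore contribute exactly `-½ (e^{-βU})''`,
which cancels the diffusion. What is left comes from the Hölder modulus of `ν` and from the second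
order Taylor remainder of `e^{-βU}`: with jumps of length of order `αβ` both are, after division by
`α` and by `e^{-βU}`, of order `(αβ²)^a β²`.
-/

namespace CircleMeans

noncomputable section

/-! ### Integrals against a displacement profile -/

/-- A nonnegative nondecreasing function `φ` on `[0, T]` with derivative `φ'` on `(0, T]`: the
length of the jump as a function of the distance to the target. No bound is imposed on `φ'`, which
blows up at `0` for `φ θ = θ ^ q` with `0 < q < 1`. -/
structure IsProfile (T : ℝ) (φ φ' : ℝ → ℝ) : Prop where
  length_nonneg : 0 ≤ T
  continuous : Continuous φ
  hasDerivAt : ∀ θ ∈ Ioc 0 T, HasDerivAt φ (φ' θ) θ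
  deriv_nonneg : ∀ θ ∈ Ioc 0 T, 0 ≤ φ' θ
  zero_nonneg : 0 ≤ φ 0

/-- The integral over `[0, T]` of the translate `N (z + ·)` against `φ`. -/
def slidingIntegral (T : ℝ) (φ N : ℝ → ℝ) (z : ℝ) : ℝ := ∫ θ in 0..T, φ θ * N (z + θ)

/-- The derivative of `slidingIntegral T φ N`, integrated by parts so that it only involves the
values of `N`. -/
def slidingDeriv (T : ℝ) (φ φ' N : ℝ → ℝ) (z : ℝ) : ℝ :=
  φ T * N (z + T) - φ 0 * N z - ∫ θ in 0..T, φ' θ * N (z + θ)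

theorem isProfile_rpow {T q : ℝ} (hT : 0 ≤ T) (hq : 0 ≤ q) :
    IsProfile T (fun θ => θ ^ q) (fun θ => q * θ ^ (q - 1)) where
  length_nonneg := hT
  continuous := Real.continuous_rpow_const hq
  hasDerivAt _ hθ := Real.hasDerivAt_rpow_const (Or.inl hθ.1.ne')
  deriv_nonneg _ hθ := mul_nonneg hq (Real.rpow_nonneg hθ.1.le _)
  zero_nonneg := Real.rpow_nonneg le_rfl q

section Translates

variable {a b : ℝ} {k N : ℝ → ℝ}

theorem intervalIntegrable_mul_comp_add (hk : IntervalIntegrable k volume a b) (hN : Continuous N)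
    (z : ℝ) : IntervalIntegrable (fun θ => k θ * N (z + θ)) volume a b :=
  hk.mul_continuousOn (by fun_prop)

theorem exists_abs_comp_add_le (hN : Continuous N) (a b z : ℝ) :
    ∃ K, ∀ x ∈ Metric.ball z 1, ∀ θ ∈ uIoc a b, |N (x + θ)| ≤ K := by
  have hcompact : IsCompact (Metric.closedBall z 1 ×ˢ uIcc a b) :=
    (isCompact_closedBall z 1).prod isCompact_uIcc
  obtain ⟨K, hK⟩ := hcompact.exists_bound_of_continuousOn
    (f := fun w : ℝ × ℝ => N (w.1 + w.2)) (by fun_prop)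
  exact ⟨K, fun x hx θ hθ => hK (x, θ) ⟨Metric.ball_subset_closedBall hx, uIoc_subset_uIcc hθ⟩⟩

theorem norm_mul_le_norm_mul {c x K : ℝ} (h : |x| ≤ K) : ‖c * x‖ ≤ ‖c‖ * K := by
  rw [norm_mul]
  exact mul_le_mul_of_nonneg_left h (norm_nonneg c)

theorem continuous_integral_mul_comp_add (hk : IntervalIntegrable k volume a b)
    (hN : Continuous N) : Continuous fun z => ∫ θ in a..b, k θ * N (z + θ) := by
  refine continuous_iff_continuousAt.2 fun z => ?_
  obtain ⟨K, hK⟩ := exists_abs_comp_add_le hN a b z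
  refine intervalIntegral.continuousAt_of_dominated_interval (bound := fun θ => ‖k θ‖ * K)
    (.of_forall fun x => (intervalIntegrable_mul_comp_add hk hN x).def'.aestronglyMeasurable)
    ?_ (hk.norm.mul_const K) (.of_forall fun θ _ => by fun_prop)
  filter_upwards [Metric.ball_mem_nhds z one_pos] with x hx
  exact .of_forall fun θ hθ => norm_mul_le_norm_mul (hK x hx θ hθ)

theorem hasDerivAt_integral_mul_comp_add {G : ℝ → ℝ} (hk : IntervalIntegrable k volume a b)
    (hN : Continuous N) (hG : ∀ x, HasDerivAt G (N x) x) (z : ℝ) :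
    HasDerivAt (fun z => ∫ θ in a..b, k θ * G (z + θ)) (∫ θ in a..b, k θ * N (z + θ)) z := by
  have hGc : Continuous G := continuous_iff_continuousAt.2 fun x => (hG x).continuousAt
  obtain ⟨K, hK⟩ := exists_abs_comp_add_le hN a b z
  exact (intervalIntegral.hasDerivAt_integral_of_dominated_loc_of_deriv_le
    (bound := fun θ => ‖k θ‖ * K) (Metric.ball_mem_nhds z one_pos)
    (.of_forall fun x => (intervalIntegrable_mul_comp_add hk hGc x).def'.aestronglyMeasurable)
    (intervalIntegrable_mul_comp_add hk hGc z)
    (intervalIntegrable_mul_comp_add hk hN z).def'.aestronglyMeasurable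
    (.of_forall fun θ hθ x hx => norm_mul_le_norm_mul (hK x hx θ hθ)) (hk.norm.mul_const K)
    (.of_forall fun θ _ x _ => ((hG (x + θ)).comp_add_const x θ).const_mul _)).2

theorem hasDerivAt_primitive (hN : Continuous N) (z : ℝ) :
    HasDerivAt (fun x => ∫ t in 0..x, N t) (N z) z :=
  (hN.integral_hasStrictDerivAt 0 z).hasDerivAt

end Translates

section Profile

variable {T : ℝ} {φ φ' N : ℝ → ℝ}

theorem IsProfile.const_mul (hφ : IsProfile T φ φ') {c : ℝ} (hc : 0 ≤ c) :
    IsProfile T (fun θ => c * φ θ) (fun θ => c * φ' θ) where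
  length_nonneg := hφ.length_nonneg
  continuous := hφ.continuous.const_mul c
  hasDerivAt θ hθ := (hφ.hasDerivAt θ hθ).const_mul c
  deriv_nonneg θ hθ := mul_nonneg hc (hφ.deriv_nonneg θ hθ)
  zero_nonneg := mul_nonneg hc hφ.zero_nonneg

theorem IsProfile.monotoneOn (hφ : IsProfile T φ φ') : MonotoneOn φ (Icc 0 T) :=
  monotoneOn_of_hasDerivWithinAt_nonneg (convex_Icc 0 T) hφ.continuous.continuousOn
    (fun θ hθ => (hφ.hasDerivAt θ (Ioo_subset_Ioc_self (by simpa using hθ))).hasDerivWithinAt)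
    fun θ hθ => hφ.deriv_nonneg θ (Ioo_subset_Ioc_self (by simpa using hθ))

theorem IsProfile.nonneg (hφ : IsProfile T φ φ') {θ : ℝ} (hθ : θ ∈ Icc 0 T) : 0 ≤ φ θ :=
  hφ.zero_nonneg.trans (hφ.monotoneOn (left_mem_Icc.2 hφ.length_nonneg) hθ hθ.1)

theorem IsProfile.le_right (hφ : IsProfile T φ φ') {θ : ℝ} (hθ : θ ∈ Icc 0 T) : φ θ ≤ φ T :=
  hφ.monotoneOn hθ (right_mem_Icc.2 hφ.length_nonneg) hθ.2

theorem IsProfile.right_nonneg (hφ : IsProfile T φ φ') : 0 ≤ φ T :=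
  hφ.nonneg (right_mem_Icc.2 hφ.length_nonneg)

theorem IsProfile.abs_le_right (hφ : IsProfile T φ φ') {θ : ℝ} (hθ : θ ∈ Icc 0 T) :
    |φ θ| ≤ φ T :=
  (abs_of_nonneg (hφ.nonneg hθ)).trans_le (hφ.le_right hθ)

theorem IsProfile.intervalIntegrable_deriv (hφ : IsProfile T φ φ') :
    IntervalIntegrable φ' volume 0 T := by
  have h0T := hφ.length_nonneg
  refine intervalIntegral.intervalIntegrable_deriv_of_nonneg hφ.continuous.continuousOn
    (fun θ hθ => ?_) fun θ hθ => ?_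
  all_goals rw [min_eq_left h0T, max_eq_right h0T] at hθ
  exacts [hφ.hasDerivAt θ (Ioo_subset_Ioc_self hθ), hφ.deriv_nonneg θ (Ioo_subset_Ioc_self hθ)]

theorem IsProfile.integral_deriv (hφ : IsProfile T φ φ') : ∫ θ in 0..T, φ' θ = φ T - φ 0 :=
  intervalIntegral.integral_eq_sub_of_hasDerivAt_of_le hφ.length_nonneg
    hφ.continuous.continuousOn (fun θ hθ => hφ.hasDerivAt θ (Ioo_subset_Ioc_self hθ))
    hφ.intervalIntegrable_deriv

theorem IsProfile.abs_integral_deriv_mul_le (hφ : IsProfile T φ φ') {f : ℝ → ℝ} {K : ℝ}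
    (hf : ∀ θ ∈ Icc 0 T, |f θ| ≤ K) : |∫ θ in 0..T, φ' θ * f θ| ≤ φ T * K := by
  have hK : 0 ≤ K := (abs_nonneg _).trans (hf 0 (left_mem_Icc.2 hφ.length_nonneg))
  have hle : ∀ θ ∈ Ioc 0 T, ‖φ' θ * f θ‖ ≤ φ' θ * K := fun θ hθ => by
    rw [norm_mul, Real.norm_of_nonneg (hφ.deriv_nonneg θ hθ)]
    exact mul_le_mul_of_nonneg_left (hf θ (Ioc_subset_Icc_self hθ)) (hφ.deriv_nonneg θ hθ)
  calc |∫ θ in 0..T, φ' θ * f θ| ≤ ∫ θ in 0..T, φ' θ * K :=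
        intervalIntegral.norm_integral_le_of_norm_le hφ.length_nonneg (.of_forall hle)
          (hφ.intervalIntegrable_deriv.mul_const K)
    _ = (φ T - φ 0) * K := by rw [intervalIntegral.integral_mul_const, hφ.integral_deriv]
    _ ≤ φ T * K := mul_le_mul_of_nonneg_right (sub_le_self _ hφ.zero_nonneg) hK

theorem abs_integral_le_length_mul {f : ℝ → ℝ} {K : ℝ} (hT : 0 ≤ T)
    (hf : ∀ θ ∈ Icc 0 T, |f θ| ≤ K) : |∫ θ in 0..T, f θ| ≤ T * K := by
  have h := intervalIntegral.norm_integral_le_of_norm_le_const (a := 0) (b := T) (f := f)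
    fun θ hθ => hf θ (Ioc_subset_Icc_self (uIoc_of_le hT ▸ hθ))
  rwa [sub_zero, abs_of_nonneg hT, mul_comm] at h

theorem slidingIntegral_eq_primitive (hφ : IsProfile T φ φ') (hN : Continuous N) (z : ℝ) :
    slidingIntegral T φ N z =
      φ T * (∫ t in 0..(z + T), N t) - φ 0 * (∫ t in 0..z, N t) -
        ∫ θ in 0..T, φ' θ * ∫ t in 0..(z + θ), N t := by
  have hprim : Continuous fun x => ∫ t in 0..x, N t :=
    intervalIntegral.continuous_primitive hN.intervalIntegrable 0
  have h := intervalIntegral.integral_mul_deriv_eq_deriv_mul_of_hasDerivAt (a := 0) (b := T)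
    (u := φ) (v := fun θ => ∫ t in 0..(z + θ), N t) (u' := φ') (v' := fun θ => N (z + θ))
    hφ.continuous.continuousOn
    (hprim.comp (continuous_const.add continuous_id)).continuousOn
    (fun θ hθ => hφ.hasDerivAt θ (Ioo_subset_Ioc_self (by
      rwa [min_eq_left hφ.length_nonneg, max_eq_right hφ.length_nonneg] at hθ)))
    (fun θ _ => (hasDerivAt_primitive hN (z + θ)).comp_const_add z θ)
    hφ.intervalIntegrable_deriv ((hN.comp (continuous_const_add z)).intervalIntegrable _ _)
  simpa only [slidingIntegral, add_zero] using h

theorem hasDerivAt_slidingIntegral (hφ : IsProfile T φ φ') (hN : Continuous N) (z : ℝ) :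
    HasDerivAt (slidingIntegral T φ N) (slidingDeriv T φ φ' N z) z := by
  rw [funext (slidingIntegral_eq_primitive hφ hN)]
  exact ((((hasDerivAt_primitive hN (z + T)).comp_add_const z T).const_mul _).sub
    ((hasDerivAt_primitive hN z).const_mul _)).sub
    (hasDerivAt_integral_mul_comp_add hφ.intervalIntegrable_deriv hN (hasDerivAt_primitive hN) z)

theorem continuous_slidingDeriv (hφ : IsProfile T φ φ') (hN : Continuous N) :
    Continuous (slidingDeriv T φ φ' N) :=
  ((continuous_const.mul (hN.comp (continuous_add_const T))).sub (continuous_const.mul hN)).sub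
    (continuous_integral_mul_comp_add hφ.intervalIntegrable_deriv hN)

theorem abs_slidingIntegral_le (hφ : IsProfile T φ φ') {M : ℝ} (hM : ∀ t, |N t| ≤ M) (z : ℝ) :
    |slidingIntegral T φ N z| ≤ T * (φ T * M) := by
  refine abs_integral_le_length_mul hφ.length_nonneg fun θ hθ => ?_
  rw [abs_mul]
  exact mul_le_mul (hφ.abs_le_right hθ) (hM _) (abs_nonneg _) hφ.right_nonneg

theorem abs_slidingDeriv_le (hφ : IsProfile T φ φ') {M : ℝ} (hM : ∀ t, |N t| ≤ M) (z : ℝ) :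
    |slidingDeriv T φ φ' N z| ≤ 3 * (φ T * M) := by
  have hmul : ∀ θ ∈ Icc 0 T, ∀ t, |φ θ * N t| ≤ φ T * M := fun θ hθ t => by
    rw [abs_mul]
    exact mul_le_mul (hφ.abs_le_right hθ) (hM t) (abs_nonneg _) hφ.right_nonneg
  have hright := hmul T (right_mem_Icc.2 hφ.length_nonneg) (z + T)
  have hleft := hmul 0 (left_mem_Icc.2 hφ.length_nonneg) z
  have hint := hφ.abs_integral_deriv_mul_le (f := fun θ => N (z + θ)) fun θ _ => hM _
  calc |slidingDeriv T φ φ' N z|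
      ≤ |φ T * N (z + T)| + |φ 0 * N z| + |∫ θ in 0..T, φ' θ * N (z + θ)| :=
        (abs_sub _ _).trans (add_le_add_left (abs_sub _ _) _)
    _ ≤ 3 * (φ T * M) := by linarith

end Profile

/-! ### Integrals of displaced functions -/

section Displacement

variable {T : ℝ} {φ φ' N : ℝ → ℝ}

theorem abs_primitive_sub_add_mul_le {x s ω : ℝ} (hN : Continuous N) (hs : 0 ≤ s)
    (hω : ∀ t ∈ Icc (x - s) x, |N t - N x| ≤ ω) :
    |(∫ t in 0..(x - s), N t) - (∫ t in 0..x, N t) + s * N x| ≤ ω * s := by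
  have hsub : (∫ t in 0..(x - s), N t) - (∫ t in 0..x, N t) + s * N x =
      ∫ t in x..(x - s), (N t - N x) := by
    rw [intervalIntegral.integral_sub (hN.intervalIntegrable _ _) (by simp),
      ← intervalIntegral.integral_interval_sub_left
        (hN.intervalIntegrable 0 (x - s)) (hN.intervalIntegrable 0 x)]
    simp
  have hle := intervalIntegral.norm_integral_le_of_norm_le_const (a := x) (b := x - s)
    (f := fun t => N t - N x) fun t ht =>
      hω t (Ioc_subset_Icc_self (uIoc_of_ge (sub_le_self x hs) ▸ ht))
  rwa [← hsub, sub_sub_cancel_left, abs_neg, abs_of_nonneg hs] at hle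

theorem continuous_comp_displaced (hφ : IsProfile T φ φ') (hN : Continuous N) (z : ℝ) :
    Continuous fun θ => N (z + θ - φ θ) :=
  hN.comp ((continuous_const_add z).sub hφ.continuous)

theorem integral_displaced_sub_integral_deriv_mul (hφ : IsProfile T φ φ') (hN : Continuous N)
    (z : ℝ) :
    (∫ θ in 0..T, N (z + θ - φ θ)) - ∫ θ in 0..T, φ' θ * N (z + θ - φ θ) =
      (∫ t in 0..(z + T - φ T), N t) - ∫ t in 0..(z - φ 0), N t := by
  have hint := (continuous_comp_displaced hφ hN z).intervalIntegrable (μ := volume) 0 T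
  have hint' := hφ.intervalIntegrable_deriv.mul_continuousOn
    (continuous_comp_displaced hφ hN z).continuousOn
  have hprim : Continuous fun x => ∫ t in 0..x, N t :=
    intervalIntegral.continuous_primitive hN.intervalIntegrable 0
  rw [← intervalIntegral.integral_sub hint hint']
  have hderiv : ∀ θ ∈ Ioo 0 T, HasDerivAt (fun θ => ∫ t in 0..(z + θ - φ θ), N t)
      (N (z + θ - φ θ) - φ' θ * N (z + θ - φ θ)) θ := fun θ hθ => by
    have hcomp := (hasDerivAt_primitive hN (z + θ - φ θ)).comp θ
      (((hasDerivAt_id θ).const_add z).sub (hφ.hasDerivAt θ (Ioo_subset_Ioc_self hθ)))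
    exact hcomp.congr_deriv (by ring)
  simpa only [add_zero] using intervalIntegral.integral_eq_sub_of_hasDerivAt_of_le
    hφ.length_nonneg (continuous_comp_displaced hφ hprim z).continuousOn hderiv (hint.sub hint')

theorem integral_displaced_sub_add_slidingDeriv (hφ : IsProfile T φ φ') (hN : Continuous N)
    (z : ℝ) :
    (∫ θ in 0..T, (N (z + θ - φ θ) - N (z + θ))) + slidingDeriv T φ φ' N z =
      ((∫ t in 0..(z + T - φ T), N t) - (∫ t in 0..(z + T), N t) + φ T * N (z + T)) -
      ((∫ t in 0..(z - φ 0), N t) - (∫ t in 0..z, N t) + φ 0 * N z) +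
      ∫ θ in 0..T, φ' θ * (N (z + θ - φ θ) - N (z + θ)) := by
  have hdisp := continuous_comp_displaced hφ hN z
  have hshift : Continuous fun θ => N (z + θ) := hN.comp (continuous_const_add z)
  have htrans : (∫ θ in 0..T, N (z + θ)) = (∫ t in 0..(z + T), N t) - ∫ t in 0..z, N t := by
    rw [intervalIntegral.integral_comp_add_left (fun t => N t), add_zero,
      intervalIntegral.integral_interval_sub_left (hN.intervalIntegrable _ _)
        (hN.intervalIntegrable _ _)]
  have hftc := integral_displaced_sub_integral_deriv_mul hφ hN z
  simp only [mul_sub]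
  rw [intervalIntegral.integral_sub (hdisp.intervalIntegrable _ _) (hshift.intervalIntegrable _ _),
    intervalIntegral.integral_sub
      (hφ.intervalIntegrable_deriv.mul_continuousOn hdisp.continuousOn)
      (intervalIntegrable_mul_comp_add hφ.intervalIntegrable_deriv hN z), htrans, slidingDeriv]
  linear_combination hftc

theorem abs_displaced_sub_le {ω : ℝ} (hφ : IsProfile T φ φ')
    (hω : ∀ x y, |y - x| ≤ φ T → |N y - N x| ≤ ω) (z : ℝ) {θ : ℝ} (hθ : θ ∈ Icc 0 T) :
    |N (z + θ - φ θ) - N (z + θ)| ≤ ω := by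
  refine hω _ _ ?_
  rw [sub_sub_cancel_left, abs_neg]
  exact hφ.abs_le_right hθ

theorem abs_integral_displaced_sub_add_slidingDeriv_le {ω : ℝ} (hφ : IsProfile T φ φ')
    (hN : Continuous N) (hω : ∀ x y, |y - x| ≤ φ T → |N y - N x| ≤ ω) (z : ℝ) :
    |(∫ θ in 0..T, (N (z + θ - φ θ) - N (z + θ))) + slidingDeriv T φ φ' N z| ≤
      3 * (φ T * ω) := by
  have hprim : ∀ x, ∀ θ ∈ Icc 0 T,
      |(∫ t in 0..(x - φ θ), N t) - (∫ t in 0..x, N t) + φ θ * N x| ≤ φ T * ω := by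
    intro x θ hθ
    have hosc : ∀ t ∈ Icc (x - φ θ) x, |N t - N x| ≤ ω := fun t ht =>
      hω x t (abs_le.2 ⟨by linarith [ht.1, hφ.le_right hθ], by linarith [ht.2, hφ.right_nonneg]⟩)
    have hω0 : 0 ≤ ω := (abs_nonneg _).trans (hosc x ⟨sub_le_self x (hφ.nonneg hθ), le_rfl⟩)
    refine (abs_primitive_sub_add_mul_le hN (hφ.nonneg hθ) hosc).trans ?_
    rw [mul_comm]
    exact mul_le_mul_of_nonneg_right (hφ.le_right hθ) hω0
  have hright := hprim (z + T) T (right_mem_Icc.2 hφ.length_nonneg)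
  have hleft := hprim z 0 (left_mem_Icc.2 hφ.length_nonneg)
  have hint := hφ.abs_integral_deriv_mul_le (f := fun θ => N (z + θ - φ θ) - N (z + θ))
    fun θ hθ => abs_displaced_sub_le hφ hω z hθ
  rw [integral_displaced_sub_add_slidingDeriv hφ hN z]
  refine ((abs_add_le _ _).trans (add_le_add_left (abs_sub _ _) _)).trans ?_
  linarith

theorem integral_weighted_displaced_sub {w : ℝ → ℝ} (hφ : IsProfile T φ φ') (hN : Continuous N)
    (hw : Continuous w) (b z : ℝ) :
    (∫ θ in 0..T, (w θ * N (z + θ - φ θ) - N (z + θ))) + slidingDeriv T φ φ' N z -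
        b * slidingIntegral T φ N z =
      ((∫ θ in 0..T, (N (z + θ - φ θ) - N (z + θ))) + slidingDeriv T φ φ' N z) +
      b * (∫ θ in 0..T, φ θ * (N (z + θ - φ θ) - N (z + θ))) +
      ∫ θ in 0..T, (w θ - 1 - b * φ θ) * N (z + θ - φ θ) := by
  have := hφ.continuous
  have hsplit : (∫ θ in 0..T, (w θ * N (z + θ - φ θ) - N (z + θ))) =
      (∫ θ in 0..T, (N (z + θ - φ θ) - N (z + θ))) +
      b * (∫ θ in 0..T, φ θ * (N (z + θ - φ θ) - N (z + θ))) +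
      b * (∫ θ in 0..T, φ θ * N (z + θ)) +
      ∫ θ in 0..T, (w θ - 1 - b * φ θ) * N (z + θ - φ θ) := by
    rw [← intervalIntegral.integral_const_mul, ← intervalIntegral.integral_const_mul,
      ← intervalIntegral.integral_add, ← intervalIntegral.integral_add,
      ← intervalIntegral.integral_add]
    · exact intervalIntegral.integral_congr fun θ _ => by ring
    all_goals exact Continuous.intervalIntegrable (by fun_prop) _ _
  rw [hsplit, slidingIntegral]
  ring

theorem abs_integral_weighted_displaced_sub_le {w : ℝ → ℝ} {ω b B M ε : ℝ}
    (hφ : IsProfile T φ φ') (hN : Continuous N)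
    (hω : ∀ x y, |y - x| ≤ φ T → |N y - N x| ≤ ω) (hM : ∀ t, |N t| ≤ M)
    (hw : Continuous w) (hb : |b| ≤ B) (hε : ∀ θ ∈ Icc 0 T, |w θ - 1 - b * φ θ| ≤ ε) (z : ℝ) :
    |(∫ θ in 0..T, (w θ * N (z + θ - φ θ) - N (z + θ))) + slidingDeriv T φ φ' N z -
        b * slidingIntegral T φ N z| ≤
      3 * (φ T * ω) + B * (T * (φ T * ω)) + T * (ε * M) := by
  have h0 := left_mem_Icc.2 hφ.length_nonneg
  have hdrift : |∫ θ in 0..T, φ θ * (N (z + θ - φ θ) - N (z + θ))| ≤ T * (φ T * ω) :=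
    abs_integral_le_length_mul hφ.length_nonneg fun θ hθ => by
      rw [abs_mul]
      exact mul_le_mul (hφ.abs_le_right hθ) (abs_displaced_sub_le hφ hω z hθ) (abs_nonneg _)
        hφ.right_nonneg
  have hweight : |∫ θ in 0..T, (w θ - 1 - b * φ θ) * N (z + θ - φ θ)| ≤ T * (ε * M) :=
    abs_integral_le_length_mul hφ.length_nonneg fun θ hθ => by
      rw [abs_mul]
      exact mul_le_mul (hε θ hθ) (hM _) (abs_nonneg _) ((abs_nonneg _).trans (hε 0 h0))
  rw [integral_weighted_displaced_sub hφ hN hw b z]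
  refine ((abs_add_le _ _).trans (add_le_add_left (abs_add_le _ _) _)).trans ?_
  rw [abs_mul b]
  exact add_le_add (add_le_add (abs_integral_displaced_sub_add_slidingDeriv_le hφ hN hω z)
    (mul_le_mul hb hdrift (abs_nonneg _) ((abs_nonneg b).trans hb))) hweight

end Displacement

/-! ### The exponential weight -/

theorem abs_exp_sub_one_sub_le (x : ℝ) : |Real.exp x - 1 - x| ≤ x ^ 2 * Real.exp |x| := by
  have h := Complex.norm_exp_sub_sum_le_norm_mul_exp (x : ℂ) 2
  rw [show Complex.exp x - ∑ m ∈ Finset.range 2, (x : ℂ) ^ m / m.factorial =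
      ((Real.exp x - 1 - x : ℝ) : ℂ) by
    push_cast [Finset.sum_range_succ, Nat.factorial]; ring,
    Complex.norm_real, Complex.norm_real, Real.norm_eq_abs, Real.norm_eq_abs, sq_abs] at h
  exact h

section Taylor

variable {V V' : ℝ → ℝ}

theorem abs_sub_le_mul_of_hasDerivAt {K : ℝ} (hV : ∀ z, HasDerivAt V (V' z) z)
    (hK : ∀ z, |V' z| ≤ K) (x y : ℝ) : |V y - V x| ≤ K * |y - x| :=
  convex_univ.norm_image_sub_le_of_norm_hasDerivWithin_le
    (fun z _ => (hV z).hasDerivWithinAt) (fun z _ => hK z) (mem_univ x) (mem_univ y)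

theorem abs_sub_sub_mul_le {V'' : ℝ → ℝ} {K : ℝ} (hV : ∀ z, HasDerivAt V (V' z) z)
    (hV' : ∀ z, HasDerivAt V' (V'' z) z) (hK : ∀ z, |V'' z| ≤ K) (x y : ℝ) :
    |V y - V x - V' x * (y - x)| ≤ K * |y - x| ^ 2 := by
  have hderiv : ∀ z ∈ uIcc x y,
      HasDerivWithinAt (fun z => V z - V' x * z) (V' z - V' x) (uIcc x y) z := fun z _ =>
    ((hV z).sub (((hasDerivAt_id z).const_mul (V' x)).congr_deriv (mul_one _))).hasDerivWithinAt
  have hbound : ∀ z ∈ uIcc x y, ‖V' z - V' x‖ ≤ K * |y - x| := fun z hz =>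
    (abs_sub_le_mul_of_hasDerivAt hV' hK x z).trans (mul_le_mul_of_nonneg_left
      (abs_sub_left_of_mem_uIcc hz) ((abs_nonneg _).trans (hK x)))
  have h := (convex_uIcc x y).norm_image_sub_le_of_norm_hasDerivWithin_le hderiv hbound
    left_mem_uIcc right_mem_uIcc
  rw [Real.norm_eq_abs, Real.norm_eq_abs, mul_assoc, ← pow_two] at h
  convert h using 2
  ring

theorem abs_exp_increment_sub_le {V'' : ℝ → ℝ} {B₁ B₂ β s S : ℝ}
    (hV : ∀ z, HasDerivAt V (V' z) z) (hV' : ∀ z, HasDerivAt V' (V'' z) z)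
    (hB₁ : ∀ z, |V' z| ≤ B₁) (hB₂ : ∀ z, |V'' z| ≤ B₂) (hβ : 0 ≤ β) (hs : |s| ≤ S) (z : ℝ) :
    |Real.exp (-β * (V (z - s) - V z)) - 1 - β * V' z * s| ≤
      (β * B₁ * S) ^ 2 * Real.exp (β * B₁ * S) + β * B₂ * S ^ 2 := by
  have hB₁0 : 0 ≤ B₁ := (abs_nonneg _).trans (hB₁ 0)
  have hB₂0 : 0 ≤ B₂ := (abs_nonneg _).trans (hB₂ 0)
  have hstep : |z - s - z| ≤ S := by rwa [sub_sub_cancel_left, abs_neg]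
  have hfirst : |-β * (V (z - s) - V z)| ≤ β * B₁ * S := by
    rw [abs_mul, abs_neg, abs_of_nonneg hβ, mul_assoc]
    exact mul_le_mul_of_nonneg_left ((abs_sub_le_mul_of_hasDerivAt hV hB₁ _ _).trans
      (mul_le_mul_of_nonneg_left hstep hB₁0)) hβ
  have hsecond : |-β * (V (z - s) - V z - V' z * (z - s - z))| ≤ β * B₂ * S ^ 2 := by
    rw [abs_mul, abs_neg, abs_of_nonneg hβ, mul_assoc]
    exact mul_le_mul_of_nonneg_left ((abs_sub_sub_mul_le hV hV' hB₂ _ _).trans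
      (mul_le_mul_of_nonneg_left (pow_le_pow_left₀ (abs_nonneg _) hstep 2) hB₂0)) hβ
  have hexp := (abs_exp_sub_one_sub_le (-β * (V (z - s) - V z))).trans (mul_le_mul
    (sq_le_sq' (neg_le_of_abs_le hfirst) (le_of_abs_le hfirst)) (Real.exp_le_exp.2 hfirst)
    (Real.exp_nonneg _) (sq_nonneg _))
  calc _ = |(Real.exp (-β * (V (z - s) - V z)) - 1 - -β * (V (z - s) - V z)) +
        -β * (V (z - s) - V z - V' z * (z - s - z))| := by ring_nf
    _ ≤ _ := (abs_add_le _ _).trans (add_le_add hexp hsecond)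

end Taylor

/-! ### Analysis on the circle -/

theorem integral_unif (g : Torus → ℝ) :
    ∫ x, g x ∂unif = (2 * Real.pi)⁻¹ * ∫ t in (-Real.pi)..Real.pi, g t := by
  have h := AddCircle.intervalIntegral_preimage (2 * Real.pi) (-Real.pi) g
  rw [show -Real.pi + 2 * Real.pi = Real.pi by ring, AddCircle.volume_eq_smul_haarAddCircle,
    integral_smul_measure, ENNReal.toReal_ofReal Real.two_pi_pos.le, smul_eq_mul] at h
  rw [h, inv_mul_cancel_left₀ Real.two_pi_pos.ne']

theorem intervalIntegrable_comp_coe {g : Torus → ℝ} (hg : Integrable g unif) :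
    IntervalIntegrable (fun t : ℝ => g t) volume (-Real.pi) Real.pi := by
  have hvol : Integrable g volume := by
    rw [AddCircle.volume_eq_smul_haarAddCircle]
    exact hg.smul_measure ENNReal.ofReal_ne_top
  rw [intervalIntegrable_iff_integrableOn_Ioc_of_le (by linarith [Real.pi_pos])]
  have h := (AddCircle.measurePreserving_mk (2 * Real.pi) (-Real.pi)).integrable_comp_of_integrable
    hvol
  rwa [show -Real.pi + 2 * Real.pi = Real.pi by ring] at h

theorem integral_unif_eq_add_halves {g : Torus → ℝ} (hg : Integrable g unif) :
    ∫ x, g x ∂unif = (2 * Real.pi)⁻¹ *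
      ((∫ θ in 0..Real.pi, g θ) + ∫ θ in 0..Real.pi, g ((-θ : ℝ) : Torus)) := by
  have hint := intervalIntegrable_comp_coe hg
  have hzero : (0 : ℝ) ∈ uIcc (-Real.pi) Real.pi := by
    rw [uIcc_of_le (by linarith [Real.pi_pos])]
    exact ⟨by linarith [Real.pi_pos], Real.pi_pos.le⟩
  rw [integral_unif, ← intervalIntegral.integral_add_adjacent_intervals
      (hint.mono_set (uIcc_subset_uIcc_left hzero)) (hint.mono_set (uIcc_subset_uIcc_right hzero)),
    intervalIntegral.integral_comp_neg (fun t : ℝ => g t), neg_zero, add_comm]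

theorem norm_coe_of_abs_le {θ : ℝ} (h : |θ| ≤ Real.pi) : ‖(θ : Torus)‖ = |θ| := by
  rw [AddCircle.norm_coe_eq_abs_iff _ Real.two_pi_pos.ne', abs_of_pos Real.two_pi_pos]
  linarith

theorem rep_coe {θ : ℝ} (hθ : θ ∈ Ioc (-Real.pi) Real.pi) : rep (θ : Torus) = θ :=
  AddCircle.equivIoc_coe_of_mem ⟨hθ.1, by linarith [hθ.2]⟩

theorem dist_coe_le (x y : ℝ) : dist (x : Torus) (y : Torus) ≤ |x - y| := by
  rw [dist_eq_norm, ← AddCircle.coe_sub]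
  exact QuotientAddGroup.norm_mk_le_norm

theorem norm_le_pi (x : Torus) : ‖x‖ ≤ Real.pi := by
  have h := AddCircle.norm_le_half_period (2 * Real.pi) Real.two_pi_pos.ne' (x := x)
  rwa [abs_of_pos Real.two_pi_pos, mul_div_cancel_left₀ _ two_ne_zero] at h

theorem continuous_of_comp_coe {X : Type*} [TopologicalSpace X] {f : Torus → X}
    (h : Continuous fun t : ℝ => f t) : Continuous f :=
  (QuotientAddGroup.isQuotientMap_mk (N := AddSubgroup.zmultiples (2 * Real.pi))).continuous_iff.2 h

theorem continuous_comp_coe {n : Torus → ℝ} (hn : Continuous n) : Continuous fun t : ℝ => n t :=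
  hn.comp (AddCircle.continuous_mk' _)

theorem periodic_comp_coe (f : Torus → ℝ) : Function.Periodic (fun t : ℝ => f t) (2 * Real.pi) :=
  fun t => congrArg f (AddCircle.coe_add_period _ t)

theorem integrable_unif_of_continuous {f : Torus → ℝ} (hf : Continuous f) : Integrable f unif :=
  hf.integrable_of_hasCompactSupport (HasCompactSupport.of_compactSpace f)

theorem periodic_deriv {f : ℝ → ℝ} {T : ℝ} (hf : Function.Periodic f T) :
    Function.Periodic (deriv f) T := fun x => by
  rw [← deriv_comp_add_const, funext hf]

theorem integral_mul_deriv_eq_neg_of_periodic {f f' g g' : ℝ → ℝ} {T : ℝ}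
    (hf : Function.Periodic f T) (hg : Function.Periodic g T)
    (hff' : ∀ t, HasDerivAt f (f' t) t) (hgg' : ∀ t, HasDerivAt g (g' t) t)
    (hf' : Continuous f') (hg' : Continuous g') (a : ℝ) :
    ∫ t in a..(a + T), f t * g' t = -∫ t in a..(a + T), f' t * g t := by
  rw [intervalIntegral.integral_mul_deriv_eq_deriv_mul (fun t _ => hff' t) (fun t _ => hgg' t)
    (hf'.intervalIntegrable _ _) (hg'.intervalIntegrable _ _), hf, hg, sub_self, zero_sub]

section C2

variable (f : C2)

theorem contDiff_one_deriv_comp_coe :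
    ContDiff ℝ 1 (deriv fun t : ℝ => (f : C(Torus, ℝ)) t) :=
  ((contDiff_succ_iff_deriv (n := 1)).1 f.2).2.2

theorem hasDerivAt_comp_coe (t : ℝ) :
    HasDerivAt (fun t : ℝ => (f : C(Torus, ℝ)) t)
      (deriv (fun t : ℝ => (f : C(Torus, ℝ)) t) t) t :=
  have hf : ContDiff ℝ 2 fun t : ℝ => (f : C(Torus, ℝ)) t := f.2
  (hf.differentiable two_ne_zero t).hasDerivAt

theorem hasDerivAt_deriv_comp_coe (t : ℝ) :
    HasDerivAt (deriv fun t : ℝ => (f : C(Torus, ℝ)) t)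
      (secondDeriv (f : C(Torus, ℝ)) t) t := by
  rw [secondDeriv_coe, iteratedDeriv_succ, iteratedDeriv_one]
  exact ((contDiff_one_deriv_comp_coe f).differentiable one_ne_zero t).hasDerivAt

theorem integral_mul_secondDeriv_comm (g : C2) :
    ∫ x, (f : C(Torus, ℝ)) x * secondDeriv (g : C(Torus, ℝ)) x ∂unif =
      ∫ x, secondDeriv (f : C(Torus, ℝ)) x * (g : C(Torus, ℝ)) x ∂unif := by
  have hper := fun h : C2 => periodic_comp_coe (h : C(Torus, ℝ))
  have hcont := fun h : C2 => (contDiff_one_deriv_comp_coe h).continuous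
  have hcont₂ := fun h : C2 => continuous_comp_coe (continuous_secondDeriv h)
  have hleft := integral_mul_deriv_eq_neg_of_periodic (hper f) (periodic_deriv (hper g))
    (hasDerivAt_comp_coe f) (hasDerivAt_deriv_comp_coe g) (hcont f) (hcont₂ g) (-Real.pi)
  have hright := integral_mul_deriv_eq_neg_of_periodic (periodic_deriv (hper f)) (hper g)
    (hasDerivAt_deriv_comp_coe f) (hasDerivAt_comp_coe g) (hcont₂ f) (hcont g) (-Real.pi)
  rw [show -Real.pi + 2 * Real.pi = Real.pi by ring] at hleft hright
  rw [integral_unif, integral_unif, hleft, hright, neg_neg]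

end C2

/-! ### Densities -/

/-- `n` is a continuous density of `ν` with respect to the uniform measure. -/
structure IsContinuousDensity (n : Torus → ℝ) (ν : Measure Torus) : Prop where
  nonneg : ∀ x, 0 ≤ n x
  continuous : Continuous n
  eq_withDensity : ν = unif.withDensity fun x => ENNReal.ofReal (n x)

theorem continuous_of_abs_sub_le_mul_dist_rpow {X : Type*} [PseudoMetricSpace X] {f : X → ℝ}
    {A a : ℝ} (ha : 0 < a) (hf : ∀ x y, |f y - f x| ≤ A * dist x y ^ a) : Continuous f := by
  refine continuous_iff_continuousAt.2 fun x => tendsto_iff_norm_sub_tendsto_zero.2 ?_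
  have hbound : Continuous fun y => A * dist x y ^ a :=
    continuous_const.mul ((Real.continuous_rpow_const ha.le).comp (continuous_const.dist
      continuous_id))
  have hlim := hbound.tendsto x
  rw [dist_self, Real.zero_rpow ha.ne', mul_zero] at hlim
  exact squeeze_zero (fun _ => norm_nonneg _) (hf x) hlim

section Density

variable {n : Torus → ℝ} {ν : Measure Torus} {a A : ℝ}

theorem HasHolderDensity.exists_isContinuousDensity (ha : 0 < a) (hν : HasHolderDensity ν a A) :
    ∃ n, IsContinuousDensity n ν ∧ ∀ x y, |n y - n x| ≤ A * dist x y ^ a :=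
  let ⟨n, hn0, hn, hνn⟩ := hν
  ⟨n, ⟨hn0, continuous_of_abs_sub_le_mul_dist_rpow ha hn, hνn⟩, hn⟩

theorem IsContinuousDensity.integral_eq (hn : IsContinuousDensity n ν) (g : Torus → ℝ) :
    ∫ x, g x ∂ν = ∫ x, n x * g x ∂unif := by
  rw [hn.eq_withDensity, integral_withDensity_eq_integral_toReal_smul
    hn.continuous.measurable.ennreal_ofReal (.of_forall fun _ => ENNReal.ofReal_lt_top)]
  simp only [ENNReal.toReal_ofReal (hn.nonneg _), smul_eq_mul]

theorem IsContinuousDensity.integral_eq_one [IsProbabilityMeasure ν]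
    (hn : IsContinuousDensity n ν) : ∫ x, n x ∂unif = 1 := by
  simpa using (hn.integral_eq fun _ => 1).symm

theorem le_integral_add_of_oscillation_le {f : Torus → ℝ} {K : ℝ} (hf : Continuous f)
    (hK : ∀ x y, |f y - f x| ≤ K) (x : Torus) : f x ≤ (∫ y, f y ∂unif) + K := by
  have hmono := integral_mono (μ := unif) (integrable_const (f x - K))
    (integrable_unif_of_continuous hf) fun y => by linarith [neg_le_of_abs_le (hK x y)]
  rw [integral_const, probReal_univ, one_smul] at hmono
  linarith

theorem abs_sub_le_mul_pi_of_holder (ha : 0 < a) (ha1 : a ≤ 1) (hA : 0 ≤ A)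
    (hn : ∀ x y, |n y - n x| ≤ A * dist x y ^ a) (x y : Torus) : |n y - n x| ≤ A * Real.pi := by
  have hpi : 1 ≤ Real.pi := by linarith [Real.pi_gt_three]
  refine (hn x y).trans (mul_le_mul_of_nonneg_left ?_ hA)
  calc dist x y ^ a ≤ Real.pi ^ a :=
        Real.rpow_le_rpow dist_nonneg (dist_eq_norm x y ▸ norm_le_pi _) ha.le
    _ ≤ Real.pi := Real.rpow_le_self_of_one_le hpi ha1

theorem IsContinuousDensity.abs_le_of_holder [IsProbabilityMeasure ν]
    (hnν : IsContinuousDensity n ν) (ha : 0 < a) (ha1 : a ≤ 1) (hA : 0 ≤ A)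
    (hn : ∀ x y, |n y - n x| ≤ A * dist x y ^ a) (x : Torus) : |n x| ≤ 1 + A * Real.pi := by
  rw [abs_of_nonneg (hnν.nonneg x), ← hnν.integral_eq_one]
  exact le_integral_add_of_oscillation_le hnν.continuous
    (abs_sub_le_mul_pi_of_holder ha ha1 hA hn) x

theorem abs_comp_coe_sub_le_of_holder (ha : 0 < a) (hA : 0 ≤ A)
    (hn : ∀ x y, |n y - n x| ≤ A * dist x y ^ a) {s : ℝ} {x y : ℝ} (hs : |y - x| ≤ s) :
    |n y - n x| ≤ A * s ^ a := by
  refine (hn x y).trans (mul_le_mul_of_nonneg_left (Real.rpow_le_rpow dist_nonneg ?_ ha.le) hA)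
  rw [dist_comm]
  exact (dist_coe_le y x).trans hs

end Density

/-! ### The potential on the line -/

/-- For a `2π`-periodic `N`, the lift to the line of the potential of the measure with density `N`;
the two terms are the contributions of the targets on either side of the starting point. -/
def potentialLift (p : ℝ) (N : ℝ → ℝ) (u : ℝ) : ℝ :=
  (2 * Real.pi)⁻¹ * (slidingIntegral Real.pi (fun θ => θ ^ p) N u +
    slidingIntegral Real.pi (fun θ => θ ^ p) (fun t => N (-t)) (-u))

/-- The derivative of `potentialLift p N`. -/
def potentialLiftDeriv (p : ℝ) (N : ℝ → ℝ) (u : ℝ) : ℝ :=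
  p / (2 * Real.pi) * (slidingIntegral Real.pi (fun θ => θ ^ (p - 1)) (fun t => N (-t)) (-u) -
    slidingIntegral Real.pi (fun θ => θ ^ (p - 1)) N u)

/-- The second derivative of `potentialLift p N`. -/
def potentialLiftDeriv₂ (p : ℝ) (N : ℝ → ℝ) (u : ℝ) : ℝ :=
  -(p / (2 * Real.pi)) *
    (slidingDeriv Real.pi (fun θ => θ ^ (p - 1)) (fun θ => (p - 1) * θ ^ (p - 1 - 1)) N u +
      slidingDeriv Real.pi (fun θ => θ ^ (p - 1)) (fun θ => (p - 1) * θ ^ (p - 1 - 1))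
        (fun t => N (-t)) (-u))

theorem IsContinuousDensity.potential_coe {n : Torus → ℝ} {ν : Measure Torus} {p : ℝ}
    (hn : IsContinuousDensity n ν) (hp : 0 ≤ p) (u : ℝ) :
    potential p ν u = potentialLift p (fun t => n t) u := by
  have hnorm : ∀ θ ∈ uIcc 0 Real.pi, ‖(θ : Torus)‖ = θ := fun θ hθ => by
    rw [uIcc_of_le Real.pi_pos.le] at hθ
    rw [norm_coe_of_abs_le ((abs_of_nonneg hθ.1).trans_le hθ.2), abs_of_nonneg hθ.1]
  have hcont : Continuous fun y : Torus => n (u + y) * dist (u : Torus) (u + y) ^ p := by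
    refine (hn.continuous.comp (continuous_const_add _)).mul ?_
    exact (Real.continuous_rpow_const hp).comp (by fun_prop)
  rw [potential, hn.integral_eq, ← integral_add_left_eq_self (μ := unif) _ (u : Torus),
    integral_unif_eq_add_halves (integrable_unif_of_continuous hcont), potentialLift]
  congr 2
  all_goals
    refine intervalIntegral.integral_congr fun θ hθ => ?_
    simp only [dist_self_add_right, AddCircle.coe_neg, AddCircle.coe_add, norm_neg, hnorm θ hθ,
      neg_add, neg_neg, mul_comm]

section Potential

variable {p : ℝ} {N : ℝ → ℝ}

theorem isProfile_pi_rpow_sub_one (hp : 1 ≤ p) :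
    IsProfile Real.pi (fun θ => θ ^ (p - 1)) (fun θ => (p - 1) * θ ^ (p - 1 - 1)) :=
  isProfile_rpow Real.pi_pos.le (sub_nonneg.2 hp)

theorem slidingDeriv_rpow {T q : ℝ} (hq : 0 < q) (z : ℝ) :
    slidingDeriv T (fun θ => θ ^ q) (fun θ => q * θ ^ (q - 1)) N z =
      T ^ q * N (z + T) - q * slidingIntegral T (fun θ => θ ^ (q - 1)) N z := by
  rw [slidingDeriv, slidingIntegral, Real.zero_rpow hq.ne', zero_mul, sub_zero,
    ← intervalIntegral.integral_const_mul]
  simp only [mul_assoc]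

theorem hasDerivAt_slidingIntegral_comp_neg {T : ℝ} {φ φ' : ℝ → ℝ} (hφ : IsProfile T φ φ')
    (hN : Continuous N) (z : ℝ) :
    HasDerivAt (fun z => slidingIntegral T φ (fun t => N (-t)) (-z))
      (-slidingDeriv T φ φ' (fun t => N (-t)) (-z)) z :=
  ((hasDerivAt_slidingIntegral hφ (hN.comp continuous_neg) (-z)).comp z
    (hasDerivAt_neg z)).congr_deriv (mul_neg_one _)

theorem hasDerivAt_potentialLift (hp : 1 ≤ p) (hN : Continuous N)
    (hper : Function.Periodic N (2 * Real.pi)) (u : ℝ) :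
    HasDerivAt (potentialLift p N) (potentialLiftDeriv p N u) u := by
  have hp0 : 0 < p := one_pos.trans_le hp
  have hprofile := isProfile_rpow Real.pi_pos.le hp0.le
  have hantipode : N (-(-u + Real.pi)) = N (u + Real.pi) := by
    rw [← hper (-(-u + Real.pi))]
    ring_nf
  refine (((hasDerivAt_slidingIntegral hprofile hN u).add
    (hasDerivAt_slidingIntegral_comp_neg hprofile hN u)).const_mul (2 * Real.pi)⁻¹).congr_deriv ?_
  rw [slidingDeriv_rpow hp0, slidingDeriv_rpow hp0, hantipode, potentialLiftDeriv]
  ring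

theorem hasDerivAt_potentialLiftDeriv (hp : 1 ≤ p) (hN : Continuous N) (u : ℝ) :
    HasDerivAt (potentialLiftDeriv p N) (potentialLiftDeriv₂ p N u) u := by
  have hprofile := isProfile_pi_rpow_sub_one hp
  refine (((hasDerivAt_slidingIntegral_comp_neg hprofile hN u).sub
    (hasDerivAt_slidingIntegral hprofile hN u)).const_mul (p / (2 * Real.pi))).congr_deriv ?_
  rw [potentialLiftDeriv₂]
  ring

theorem continuous_potentialLiftDeriv₂ (hp : 1 ≤ p) (hN : Continuous N) :
    Continuous (potentialLiftDeriv₂ p N) :=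
  continuous_const.mul ((continuous_slidingDeriv (isProfile_pi_rpow_sub_one hp) hN).add
    ((continuous_slidingDeriv (isProfile_pi_rpow_sub_one hp) (hN.comp continuous_neg)).comp
      continuous_neg))

theorem abs_potentialLiftDeriv_le {M : ℝ} (hp : 1 ≤ p) (hM : ∀ t, |N t| ≤ M) (u : ℝ) :
    |potentialLiftDeriv p N u| ≤ p * Real.pi ^ (p - 1) * M := by
  have hprofile := isProfile_pi_rpow_sub_one hp
  have hright := abs_slidingIntegral_le hprofile hM u
  have hleft := abs_slidingIntegral_le hprofile (N := fun t => N (-t)) (fun t => hM (-t)) (-u)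
  have hcoef : 0 ≤ p / (2 * Real.pi) := by positivity
  rw [potentialLiftDeriv, abs_mul, abs_of_nonneg hcoef]
  refine (mul_le_mul_of_nonneg_left ((abs_sub _ _).trans (add_le_add hleft hright))
    hcoef).trans_eq ?_
  field_simp
  ring

theorem abs_potentialLiftDeriv₂_le {M : ℝ} (hp : 1 ≤ p) (hM : ∀ t, |N t| ≤ M) (u : ℝ) :
    |potentialLiftDeriv₂ p N u| ≤ p * Real.pi ^ (p - 1) * M := by
  have hprofile := isProfile_pi_rpow_sub_one hp
  have hright := abs_slidingDeriv_le hprofile hM u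
  have hleft := abs_slidingDeriv_le hprofile (N := fun t => N (-t)) (fun t => hM (-t)) (-u)
  have hcoef : 0 ≤ p / (2 * Real.pi) := by positivity
  have hM0 : 0 ≤ M := (abs_nonneg _).trans (hM 0)
  have hbound : 0 ≤ p * Real.pi ^ (p - 1) * M := by positivity
  rw [potentialLiftDeriv₂, abs_mul, abs_neg, abs_of_nonneg hcoef]
  calc _ ≤ p / (2 * Real.pi) * (3 * (Real.pi ^ (p - 1) * M) + 3 * (Real.pi ^ (p - 1) * M)) :=
        mul_le_mul_of_nonneg_left ((abs_add_le _ _).trans (add_le_add hright hleft)) hcoef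
    _ = 3 / Real.pi * (p * Real.pi ^ (p - 1) * M) := by field_simp; ring
    _ ≤ p * Real.pi ^ (p - 1) * M := mul_le_of_le_one_left hbound
        ((div_le_one Real.pi_pos).2 Real.pi_gt_three.le)

end Potential

/-! ### Duality -/

theorem integrable_mul_of_abs_le {X : Type*} [MeasurableSpace X] {μ : Measure X}
    [IsFiniteMeasure μ] {g h : X → ℝ} {K L : ℝ} (hg : Measurable g) (hh : Measurable h)
    (hK : ∀ x, |g x| ≤ K) (hL : ∀ x, |h x| ≤ L) : Integrable (fun x => g x * h x) μ :=
  (Integrable.of_bound hg.aestronglyMeasurable K (.of_forall hK)).mul_bdd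
    hh.aestronglyMeasurable (.of_forall hL)

section JumpDual

variable {G Ω : Type*} [MeasurableSpace G] [MeasurableSpace Ω] {μ : Measure G} {κ : Measure Ω}
  {J : Ω → G} {k : G → Ω → ℝ} {f : G → ℝ} {K L : ℝ}

/-- The formal adjoint, applied to `1` and with respect to an invariant measure on `G`, of the
jump operator `f ↦ ∫ w, k x w * (f (x + J w) - f x) ∂κ` with jumps `J` and rates `k`. -/
def jumpDual [Sub G] (κ : Measure Ω) (J : Ω → G) (k : G → Ω → ℝ) (z : G) : ℝ :=
  ∫ w, (k (z - J w) w - k z w) ∂κ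

theorem measurable_uncurry_comp_sub [Sub G] [MeasurableSub₂ G] (hJ : Measurable J)
    (hk : Measurable (Function.uncurry k)) :
    Measurable (Function.uncurry fun x w => k (x - J w) w) :=
  hk.comp ((measurable_fst.sub (hJ.comp measurable_snd)).prodMk measurable_snd)

theorem measurable_jumpDual [Sub G] [MeasurableSub₂ G] [SFinite κ] (hJ : Measurable J)
    (hk : Measurable (Function.uncurry k)) : Measurable (jumpDual κ J k) :=
  ((measurable_uncurry_comp_sub hJ hk).sub hk).stronglyMeasurable.integral_prod_right'.measurable

variable [IsFiniteMeasure μ] [IsFiniteMeasure κ]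

theorem integrable_uncurry_mul_comp_fst (hk : Measurable (Function.uncurry k))
    (hf : Measurable f) (hK : ∀ x w, |k x w| ≤ K) (hL : ∀ x, |f x| ≤ L) :
    Integrable (Function.uncurry fun x w => k x w * f x) (μ.prod κ) :=
  integrable_mul_of_abs_le hk (hf.comp measurable_fst) (fun x => hK x.1 x.2) fun _ => hL _

variable [AddGroup G]

theorem integrable_uncurry_mul_comp_add [MeasurableAdd₂ G] (hJ : Measurable J)
    (hk : Measurable (Function.uncurry k)) (hf : Measurable f) (hK : ∀ x w, |k x w| ≤ K)
    (hL : ∀ x, |f x| ≤ L) :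
    Integrable (Function.uncurry fun x w => k x w * f (x + J w)) (μ.prod κ) :=
  integrable_mul_of_abs_le hk (hf.comp (measurable_fst.add (hJ.comp measurable_snd)))
    (fun x => hK x.1 x.2) fun _ => hL _

theorem integrable_integral_mul_jump [MeasurableAdd₂ G] (hJ : Measurable J)
    (hk : Measurable (Function.uncurry k)) (hf : Measurable f) (hK : ∀ x w, |k x w| ≤ K)
    (hL : ∀ x, |f x| ≤ L) :
    Integrable (fun x => ∫ w, k x w * (f (x + J w) - f x) ∂κ) μ := by
  simp only [mul_sub]
  exact ((integrable_uncurry_mul_comp_add hJ hk hf hK hL).sub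
    (integrable_uncurry_mul_comp_fst hk hf hK hL)).integral_prod_left

variable [MeasurableSub₂ G]

theorem integrable_uncurry_comp_sub_sub_mul (hJ : Measurable J)
    (hk : Measurable (Function.uncurry k)) (hf : Measurable f) (hK : ∀ x w, |k x w| ≤ K)
    (hL : ∀ x, |f x| ≤ L) :
    Integrable (Function.uncurry fun z w => (k (z - J w) w - k z w) * f z) (μ.prod κ) :=
  integrable_uncurry_mul_comp_fst ((measurable_uncurry_comp_sub hJ hk).sub hk) hf
    (fun z w => (abs_sub _ _).trans (add_le_add (hK (z - J w) w) (hK z w))) hL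

theorem integrable_jumpDual_mul (hJ : Measurable J) (hk : Measurable (Function.uncurry k))
    (hf : Measurable f) (hK : ∀ x w, |k x w| ≤ K) (hL : ∀ x, |f x| ≤ L) :
    Integrable (fun z => jumpDual κ J k z * f z) μ := by
  simp only [jumpDual, ← integral_mul_const]
  exact (integrable_uncurry_comp_sub_sub_mul hJ hk hf hK hL).integral_prod_left

theorem integral_integral_mul_jump [MeasurableAdd₂ G] [μ.IsAddRightInvariant]
    (hJ : Measurable J) (hk : Measurable (Function.uncurry k)) (hf : Measurable f)
    (hK : ∀ x w, |k x w| ≤ K) (hL : ∀ x, |f x| ≤ L) :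
    ∫ x, ∫ w, k x w * (f (x + J w) - f x) ∂κ ∂μ = ∫ z, jumpDual κ J k z * f z ∂μ := by
  have hjump := integrable_uncurry_mul_comp_add (μ := μ) (κ := κ) hJ hk hf hK hL
  have hstay := integrable_uncurry_mul_comp_fst (μ := μ) (κ := κ) hk hf hK hL
  have hback := integrable_uncurry_mul_comp_fst (μ := μ) (κ := κ)
    (measurable_uncurry_comp_sub hJ hk) hf (fun x w => hK _ w) hL
  have htranslate : ∫ x, ∫ w, k x w * f (x + J w) ∂κ ∂μ =
      ∫ z, ∫ w, k (z - J w) w * f z ∂κ ∂μ := by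
    rw [integral_integral_swap hjump, integral_integral_swap hback]
    refine integral_congr_ae (.of_forall fun w => ?_)
    simpa only [sub_add_cancel] using
      (integral_sub_right_eq_self (μ := μ) (fun x => k x w * f (x + J w)) (J w)).symm
  simp only [jumpDual, ← integral_mul_const, mul_sub, sub_mul]
  exact (integral_integral_sub hjump hstay).trans
    ((congrArg (· - _) htranslate).trans (integral_integral_sub hback hstay).symm)

end JumpDual

/-- The jump from `x` towards `x + w` along the minimal geodesic, as an element of the circle: it
does not depend on `x`. -/
def jumpShift (p c : ℝ) (w : Torus) : Torus :=
  ((SignType.sign (rep w) * (c * ‖w‖ ^ (p - 1)) : ℝ) : Torus)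

theorem geod_add_eq (p c : ℝ) (x w : Torus) :
    geod x (x + w) (c * dist x (x + w) ^ (p - 1)) = x + jumpShift p c w := by
  rw [geod, jumpShift, add_sub_cancel_left, dist_self_add_right]

theorem measurable_jumpShift (p c : ℝ) : Measurable (jumpShift p c) := by
  have h := measurable_geod (x := fun _ => 0) (y := fun w => w)
    (t := fun w => c * ‖w‖ ^ (p - 1)) measurable_const measurable_id
    ((measurable_norm.pow_const (p - 1)).const_mul c)
  simp only [geod, zero_add, sub_zero] at h
  exact h

theorem jumpShift_coe (p c : ℝ) {θ : ℝ} (hθ : θ ∈ Ioo 0 Real.pi) :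
    jumpShift p c θ = ((c * θ ^ (p - 1) : ℝ) : Torus) := by
  rw [jumpShift, rep_coe ⟨by linarith [hθ.1, Real.pi_pos], hθ.2.le⟩, sign_pos hθ.1,
    norm_coe_of_abs_le ((abs_of_pos hθ.1).trans_le hθ.2.le), abs_of_pos hθ.1, SignType.coe_one,
    one_mul]

theorem jumpShift_coe_neg (p c : ℝ) {θ : ℝ} (hθ : θ ∈ Ioo 0 Real.pi) :
    jumpShift p c ((-θ : ℝ) : Torus) = ((-(c * θ ^ (p - 1)) : ℝ) : Torus) := by
  rw [jumpShift, rep_coe ⟨neg_lt_neg hθ.2, by linarith [hθ.1, Real.pi_pos]⟩,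
    sign_neg (neg_lt_zero.2 hθ.1), AddCircle.coe_neg, norm_neg,
    norm_coe_of_abs_le ((abs_of_pos hθ.1).trans_le hθ.2.le), abs_of_pos hθ.1,
    SignType.coe_neg_one, neg_one_mul]

/-- The formal adjoint in `L²(λ)` of the generator, applied to the density `E`, for a measure `ν`
with density `n`. -/
def generatorDual (p α β : ℝ) (n E : Torus → ℝ) (z : Torus) : ℝ :=
  1 / 2 * secondDeriv E z +
    1 / α * jumpDual unif (jumpShift p (p / 2 * β * α)) (fun x w => E x * n (x + w)) z

theorem exists_abs_le_of_continuous {f : Torus → ℝ} (hf : Continuous f) :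
    ∃ K, ∀ x, |f x| ≤ K :=
  ⟨_, fun x => (⟨f, hf⟩ : C(Torus, ℝ)).norm_coe_le_norm x⟩

section GeneratorDual

variable {p α β : ℝ} {n : Torus → ℝ} {ν : Measure Torus}

theorem IsContinuousDensity.genFun_eq (hn : IsContinuousDensity n ν) (f : Torus → ℝ)
    (x : Torus) :
    genFun p α β ν f x = 1 / 2 * secondDeriv f x + 1 / α *
      ∫ w, n (x + w) * (f (x + jumpShift p (p / 2 * β * α) w) - f x) ∂unif := by
  rw [genFun, hn.integral_eq, ← integral_add_left_eq_self (μ := unif) _ x]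
  simp only [geod_add_eq]

theorem measurable_uncurry_mul_comp_add {E : Torus → ℝ} (hE : Continuous E) (hn : Continuous n) :
    Measurable (Function.uncurry fun x w => E x * n (x + w)) :=
  (hE.measurable.comp measurable_fst).mul
    (hn.measurable.comp (measurable_fst.add measurable_snd))

theorem measurable_generatorDual (hn : Continuous n) (E : C2) :
    Measurable (generatorDual p α β n (E : C(Torus, ℝ))) :=
  ((continuous_secondDeriv E).measurable.const_mul _).add
    ((measurable_jumpDual (measurable_jumpShift p _)
      (measurable_uncurry_mul_comp_add (E : C(Torus, ℝ)).continuous hn)).const_mul _)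

theorem IsContinuousDensity.integral_mul_genFun (hn : IsContinuousDensity n ν) (E f : C2) :
    ∫ x, (E : C(Torus, ℝ)) x * genFun p α β ν (f : C(Torus, ℝ)) x ∂unif =
      ∫ z, generatorDual p α β n (E : C(Torus, ℝ)) z * (f : C(Torus, ℝ)) z ∂unif := by
  have hE := (E : C(Torus, ℝ)).continuous
  have hf := (f : C(Torus, ℝ)).continuous
  obtain ⟨K, hK⟩ : ∃ K, ∀ x w, |(E : C(Torus, ℝ)) x * n (x + w)| ≤ K := by
    obtain ⟨KE, hKE⟩ := exists_abs_le_of_continuous hE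
    obtain ⟨Kn, hKn⟩ := exists_abs_le_of_continuous hn.continuous
    exact ⟨KE * Kn, fun x w => (abs_mul _ _).trans_le
      (mul_le_mul (hKE _) (hKn _) (abs_nonneg _) ((abs_nonneg _).trans (hKE 0)))⟩
  obtain ⟨L, hL⟩ := exists_abs_le_of_continuous hf
  have hJ := measurable_jumpShift p (p / 2 * β * α)
  have hk := measurable_uncurry_mul_comp_add hE hn.continuous
  have hprimal := (integrable_integral_mul_jump (μ := unif) (κ := unif) hJ hk hf.measurable hK
    hL).const_mul (1 / α)
  have hdual := (integrable_jumpDual_mul (μ := unif) (κ := unif) hJ hk hf.measurable hK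
    hL).const_mul (1 / α)
  have hdiff : ∀ g h : C2, Integrable
      (fun x => 1 / 2 * ((g : C(Torus, ℝ)) x * secondDeriv (h : C(Torus, ℝ)) x)) unif :=
    fun g h => integrable_unif_of_continuous
      (continuous_const.mul ((g : C(Torus, ℝ)).continuous.mul (continuous_secondDeriv h)))
  calc _ = ∫ x, (1 / 2 * ((E : C(Torus, ℝ)) x * secondDeriv (f : C(Torus, ℝ)) x) +
        1 / α * ∫ w, (E : C(Torus, ℝ)) x * n (x + w) * ((f : C(Torus, ℝ))
          (x + jumpShift p (p / 2 * β * α) w) - (f : C(Torus, ℝ)) x) ∂unif) ∂unif := by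
        simp only [hn.genFun_eq, mul_assoc ((E : C(Torus, ℝ)) _), integral_const_mul]
        congr 1 with x
        ring
    _ = ∫ z, (1 / 2 * ((f : C(Torus, ℝ)) z * secondDeriv (E : C(Torus, ℝ)) z) +
        1 / α * (jumpDual unif (jumpShift p (p / 2 * β * α))
          (fun x w => (E : C(Torus, ℝ)) x * n (x + w)) z * (f : C(Torus, ℝ)) z)) ∂unif := by
        rw [integral_add (hdiff E f) hprimal, integral_add (hdiff f E) hdual]
        simp only [integral_const_mul]
        rw [integral_integral_mul_jump hJ hk hf.measurable hK hL, integral_mul_secondDeriv_comm]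
        simp only [mul_comm]
    _ = _ := by
        congr 1 with z
        rw [generatorDual]
        ring

end GeneratorDual

/-! ### The Gibbs weight -/

section WeightedJump

variable {T β : ℝ} {V V' V'' N φ φ' : ℝ → ℝ}

/-- The jump part of `generatorDual`, relative to the weight `exp (-β V)`, with targets of density
`N` at distance at most `T` on the right of `z` and jumps of length `φ θ` towards a target at
distance `θ`. -/
def weightedJump (T β : ℝ) (V N φ : ℝ → ℝ) (z : ℝ) : ℝ :=
  ∫ θ in 0..T, (Real.exp (-β * (V (z - φ θ) - V z)) * N (z + θ - φ θ) - N (z + θ))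

/-- The error of the first-order expansion of `weightedJump` in the jump length, where `V'` and `φ'`
are the derivatives of `V` and `φ`. -/
def weightedJumpError (T β : ℝ) (V V' N φ φ' : ℝ → ℝ) (z : ℝ) : ℝ :=
  weightedJump T β V N φ z + slidingDeriv T φ φ' N z - β * V' z * slidingIntegral T φ N z

/-- A bound for `weightedJumpError T` for jumps of length at most `S`, when `V` has first and second
derivatives bounded by `B` and the density is bounded by `M`, with oscillation at most `ω` over
intervals of length `S`. -/
def jumpRemainder (T β B M S ω : ℝ) : ℝ :=
  3 * (S * ω) + β * B * (T * (S * ω)) +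
    T * (((β * B * S) ^ 2 * Real.exp (β * B * S) + β * B * S ^ 2) * M)

theorem abs_weightedJumpError_le {B M ω : ℝ} (hφ : IsProfile T φ φ') (hN : Continuous N)
    (hω : ∀ x y, |y - x| ≤ φ T → |N y - N x| ≤ ω) (hM : ∀ t, |N t| ≤ M)
    (hV : ∀ z, HasDerivAt V (V' z) z) (hV' : ∀ z, HasDerivAt V' (V'' z) z)
    (hB₁ : ∀ z, |V' z| ≤ B) (hB₂ : ∀ z, |V'' z| ≤ B) (hβ : 0 ≤ β) (z : ℝ) :
    |weightedJumpError T β V V' N φ φ' z| ≤ jumpRemainder T β B M (φ T) ω := by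
  have hVcont : Continuous V := continuous_iff_continuousAt.2 fun z => (hV z).continuousAt
  have hw : Continuous fun θ => Real.exp (-β * (V (z - φ θ) - V z)) :=
    Real.continuous_exp.comp (continuous_const.mul
      ((hVcont.comp (continuous_const.sub hφ.continuous)).sub continuous_const))
  have hb : |β * V' z| ≤ β * B := by
    rw [abs_mul, abs_of_nonneg hβ]
    exact mul_le_mul_of_nonneg_left (hB₁ z) hβ
  exact abs_integral_weighted_displaced_sub_le hφ hN hω hM hw hb
    (fun θ hθ => abs_exp_increment_sub_le hV hV' hB₁ hB₂ hβ (hφ.abs_le_right hθ) z) z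

theorem slidingIntegral_const_mul (c z : ℝ) :
    slidingIntegral T (fun θ => c * φ θ) N z = c * slidingIntegral T φ N z := by
  simp only [slidingIntegral, mul_assoc, intervalIntegral.integral_const_mul]

theorem slidingDeriv_const_mul (c z : ℝ) :
    slidingDeriv T (fun θ => c * φ θ) (fun θ => c * φ' θ) N z = c * slidingDeriv T φ φ' N z := by
  simp only [slidingDeriv, mul_assoc, intervalIntegral.integral_const_mul, mul_sub]

theorem hasDerivAt_comp_neg {V V' : ℝ → ℝ} (hV : ∀ z, HasDerivAt V (V' z) z) (z : ℝ) :
    HasDerivAt (fun t => V (-t)) (-V' (-z)) z :=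
  ((hV (-z)).comp z (hasDerivAt_neg z)).congr_deriv (mul_neg_one _)

theorem hasDerivAt_exp_neg_mul (hV : ∀ z, HasDerivAt V (V' z) z) (z : ℝ) :
    HasDerivAt (fun z => Real.exp (-β * V z)) (-β * V' z * Real.exp (-β * V z)) z :=
  ((hV z).const_mul (-β)).exp.congr_deriv (mul_comm _ _)

theorem hasDerivAt_deriv_exp_neg_mul (hV : ∀ z, HasDerivAt V (V' z) z)
    (hV' : ∀ z, HasDerivAt V' (V'' z) z) (z : ℝ) :
    HasDerivAt (fun z => -β * V' z * Real.exp (-β * V z))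
      ((β ^ 2 * V' z ^ 2 - β * V'' z) * Real.exp (-β * V z)) z :=
  (((hV' z).const_mul (-β)).mul (hasDerivAt_exp_neg_mul hV z)).congr_deriv (by ring)

end WeightedJump

section C2

variable {f : Torus → ℝ} {f' f'' : ℝ → ℝ}

theorem deriv_comp_coe_eq (hf : ∀ u : ℝ, HasDerivAt (fun t : ℝ => f t) (f' u) u) :
    deriv (fun t : ℝ => f t) = f' :=
  funext fun u => (hf u).deriv

theorem exists_C2_of_hasDerivAt (hf : ∀ u : ℝ, HasDerivAt (fun t : ℝ => f t) (f' u) u)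
    (hf' : ∀ u, HasDerivAt f' (f'' u) u) (hf'' : Continuous f'') :
    ∃ F : C2, ⇑(F : C(Torus, ℝ)) = f := by
  have hcont : Continuous fun t : ℝ => f t :=
    continuous_iff_continuousAt.2 fun u => (hf u).continuousAt
  have h1 : ContDiff ℝ 1 f' := contDiff_one_iff_deriv.2
    ⟨fun u => (hf' u).differentiableAt, by rwa [funext fun u => (hf' u).deriv]⟩
  have h2 : ContDiff ℝ 2 fun t : ℝ => f t := contDiff_succ_iff_deriv (n := 1).2
    ⟨fun u => (hf u).differentiableAt, by simp, by rwa [deriv_comp_coe_eq hf]⟩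
  exact ⟨⟨⟨f, continuous_of_comp_coe hcont⟩, h2⟩, rfl⟩

theorem secondDeriv_coe_of_hasDerivAt (hf : ∀ u : ℝ, HasDerivAt (fun t : ℝ => f t) (f' u) u)
    (hf' : ∀ u, HasDerivAt f' (f'' u) u) (u : ℝ) : secondDeriv f u = f'' u := by
  rw [secondDeriv_coe, iteratedDeriv_succ, iteratedDeriv_one, deriv_comp_coe_eq hf]
  exact (hf' u).deriv

end C2

section Gibbs

variable {p α β : ℝ} {n : Torus → ℝ} {ν : Measure Torus}

/-- The unnormalised density of the Gibbs measure. -/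
def gibbsWeight (p β : ℝ) (ν : Measure Torus) (x : Torus) : ℝ :=
  Real.exp (-β * potential p ν x)

theorem gibbsWeight_pos (x : Torus) : 0 < gibbsWeight p β ν x := Real.exp_pos _

theorem IsContinuousDensity.gibbsWeight_coe (hn : IsContinuousDensity n ν) (hp : 0 ≤ p) (u : ℝ) :
    gibbsWeight p β ν u = Real.exp (-β * potentialLift p (fun t => n t) u) := by
  rw [gibbsWeight, hn.potential_coe hp]

theorem IsContinuousDensity.hasDerivAt_potentialLift (hn : IsContinuousDensity n ν) (hp : 1 ≤ p)
    (u : ℝ) :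
    HasDerivAt (potentialLift p fun t => n t) (potentialLiftDeriv p (fun t => n t) u) u :=
  CircleMeans.hasDerivAt_potentialLift hp (continuous_comp_coe hn.continuous)
    (periodic_comp_coe n) u

theorem IsContinuousDensity.hasDerivAt_gibbsWeight (hn : IsContinuousDensity n ν) (hp : 1 ≤ p)
    (u : ℝ) :
    HasDerivAt (fun t : ℝ => gibbsWeight p β ν t)
      (-β * potentialLiftDeriv p (fun t => n t) u *
        Real.exp (-β * potentialLift p (fun t => n t) u)) u := by
  simp only [hn.gibbsWeight_coe (zero_le_one.trans hp)]
  exact hasDerivAt_exp_neg_mul (hn.hasDerivAt_potentialLift hp) u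

theorem IsContinuousDensity.hasDerivAt_deriv_gibbsWeight (hn : IsContinuousDensity n ν)
    (hp : 1 ≤ p) (u : ℝ) :
    HasDerivAt (fun u => -β * potentialLiftDeriv p (fun t => n t) u *
        Real.exp (-β * potentialLift p (fun t => n t) u))
      ((β ^ 2 * potentialLiftDeriv p (fun t => n t) u ^ 2 -
        β * potentialLiftDeriv₂ p (fun t => n t) u) *
        Real.exp (-β * potentialLift p (fun t => n t) u)) u :=
  hasDerivAt_deriv_exp_neg_mul (hn.hasDerivAt_potentialLift hp)
    (hasDerivAt_potentialLiftDeriv hp (continuous_comp_coe hn.continuous)) u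

theorem IsContinuousDensity.exists_C2_eq_gibbsWeight (hn : IsContinuousDensity n ν) (hp : 1 ≤ p) :
    ∃ E : C2, ⇑(E : C(Torus, ℝ)) = gibbsWeight p β ν := by
  have hN := continuous_comp_coe hn.continuous
  have hV : Continuous (potentialLift p fun t => n t) :=
    continuous_iff_continuousAt.2 fun u => (hn.hasDerivAt_potentialLift hp u).continuousAt
  have hV' : Continuous (potentialLiftDeriv p fun t => n t) :=
    continuous_iff_continuousAt.2 fun u => (hasDerivAt_potentialLiftDeriv hp hN u).continuousAt
  have hV'' := continuous_potentialLiftDeriv₂ hp hN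
  exact exists_C2_of_hasDerivAt (hn.hasDerivAt_gibbsWeight hp)
    (hn.hasDerivAt_deriv_gibbsWeight hp) (by fun_prop)

theorem IsContinuousDensity.secondDeriv_gibbsWeight_coe (hn : IsContinuousDensity n ν)
    (hp : 1 ≤ p) (u : ℝ) :
    secondDeriv (gibbsWeight p β ν) u =
      (β ^ 2 * potentialLiftDeriv p (fun t => n t) u ^ 2 -
        β * potentialLiftDeriv₂ p (fun t => n t) u) * gibbsWeight p β ν u := by
  rw [hn.gibbsWeight_coe (zero_le_one.trans hp)]
  exact secondDeriv_coe_of_hasDerivAt (hn.hasDerivAt_gibbsWeight hp)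
    (hn.hasDerivAt_deriv_gibbsWeight hp) u

end Gibbs

/-! ### The formal adjoint of the generator at the Gibbs weight -/

section GeneratorDualGibbs

variable {p α β : ℝ} {n : Torus → ℝ} {ν : Measure Torus}

theorem integrable_comp_sub_jump_sub {E : Torus → ℝ} {J : Torus → Torus} (hE : Continuous E)
    (hn : Continuous n) (hJ : Measurable J) (z : Torus) :
    Integrable (fun w => E (z - J w) * n (z - J w + w) - E z * n (z + w)) unif := by
  obtain ⟨K, hK⟩ := exists_abs_le_of_continuous hE
  obtain ⟨M, hM⟩ := exists_abs_le_of_continuous hn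
  have hzJ : Measurable fun w => z - J w := measurable_const.sub hJ
  exact (integrable_mul_of_abs_le (hE.measurable.comp hzJ)
    (hn.measurable.comp (hzJ.add measurable_id)) (fun _ => hK _) fun _ => hM _).sub
    (integrable_unif_of_continuous (continuous_const.mul (hn.comp (continuous_const_add z))))

theorem jumpDual_coe_of_eq_exp {E : Torus → ℝ} {V : ℝ → ℝ} (c : ℝ) (hE : Continuous E)
    (hn : Continuous n) (hEV : ∀ u : ℝ, E u = Real.exp (-β * V u)) (u : ℝ) :
    jumpDual unif (jumpShift p c) (fun x w => E x * n (x + w)) u =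
      E u / (2 * Real.pi) *
        (weightedJump Real.pi β V (fun t => n t) (fun θ => c * θ ^ (p - 1)) u +
          weightedJump Real.pi β (fun t => V (-t)) (fun t => n ((-t : ℝ) : Torus))
            (fun θ => c * θ ^ (p - 1)) (-u)) := by
  have hexp : ∀ t : ℝ, E t = E u * Real.exp (-β * (V t - V u)) := fun t => by
    rw [hEV, hEV, ← Real.exp_add]
    ring_nf
  have hright : ∫ θ in 0..Real.pi, (E (u - jumpShift p c θ) * n (u - jumpShift p c θ + θ) -
      E u * n (u + θ)) = E u * weightedJump Real.pi β V (fun t => n t)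
        (fun θ => c * θ ^ (p - 1)) u := by
    rw [weightedJump, ← intervalIntegral.integral_const_mul]
    refine intervalIntegral.integral_congr_Ioo_of_le Real.pi_pos.le fun θ hθ => ?_
    simp only [jumpShift_coe p c hθ, ← AddCircle.coe_sub, ← AddCircle.coe_add, hexp (u - _)]
    ring_nf
  have hleft : ∫ θ in 0..Real.pi, (E (u - jumpShift p c ((-θ : ℝ) : Torus)) *
      n (u - jumpShift p c ((-θ : ℝ) : Torus) + ((-θ : ℝ) : Torus)) -
      E u * n (u + ((-θ : ℝ) : Torus))) = E u * weightedJump Real.pi β (fun t => V (-t))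
        (fun t => n ((-t : ℝ) : Torus)) (fun θ => c * θ ^ (p - 1)) (-u) := by
    rw [weightedJump, ← intervalIntegral.integral_const_mul]
    refine intervalIntegral.integral_congr_Ioo_of_le Real.pi_pos.le fun θ hθ => ?_
    simp only [jumpShift_coe_neg p c hθ, ← AddCircle.coe_sub, ← AddCircle.coe_add, hexp (u - _)]
    ring_nf
  rw [jumpDual, integral_unif_eq_add_halves
    (integrable_comp_sub_jump_sub hE hn (measurable_jumpShift p c) _), hright, hleft]
  ring

/-- The sum of the expansion errors of the jumps towards the targets on either side of `u`, for the
weight `exp (-β * potentialLift p N)` and jumps of length `c * θ ^ (p - 1)`. -/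
def potentialJumpError (p c β : ℝ) (N : ℝ → ℝ) (u : ℝ) : ℝ :=
  weightedJumpError Real.pi β (potentialLift p N) (potentialLiftDeriv p N) N
      (fun θ => c * θ ^ (p - 1)) (fun θ => c * ((p - 1) * θ ^ (p - 1 - 1))) u +
    weightedJumpError Real.pi β (fun t => potentialLift p N (-t))
      (fun t => -potentialLiftDeriv p N (-t)) (fun t => N (-t))
      (fun θ => c * θ ^ (p - 1)) (fun θ => c * ((p - 1) * θ ^ (p - 1 - 1))) (-u)

theorem weightedJump_add_eq (hp : p ≠ 0) (c : ℝ) (N : ℝ → ℝ) (u : ℝ) :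
    weightedJump Real.pi β (potentialLift p N) N (fun θ => c * θ ^ (p - 1)) u +
      weightedJump Real.pi β (fun t => potentialLift p N (-t)) (fun t => N (-t))
        (fun θ => c * θ ^ (p - 1)) (-u) =
      potentialJumpError p c β N u +
        2 * Real.pi * c / p * (potentialLiftDeriv₂ p N u - β * potentialLiftDeriv p N u ^ 2) := by
  have hπ := Real.pi_pos.ne'
  simp only [potentialJumpError, weightedJumpError, slidingIntegral_const_mul,
    slidingDeriv_const_mul, neg_neg, potentialLiftDeriv, potentialLiftDeriv₂]
  field_simp
  ring

theorem IsContinuousDensity.generatorDual_gibbsWeight_coe (hn : IsContinuousDensity n ν)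
    (hp : 1 ≤ p) (hα : α ≠ 0) (u : ℝ) :
    generatorDual p α β n (gibbsWeight p β ν) u = gibbsWeight p β ν u *
      (potentialJumpError p (p / 2 * β * α) β (fun t => n t) u / (2 * Real.pi * α)) := by
  have hp0 : 0 < p := one_pos.trans_le hp
  have hπ := Real.pi_pos.ne'
  obtain ⟨E, hE⟩ := hn.exists_C2_eq_gibbsWeight (β := β) hp
  have hcont : Continuous (gibbsWeight p β ν) := hE ▸ (E : C(Torus, ℝ)).continuous
  rw [generatorDual, hn.secondDeriv_gibbsWeight_coe hp, jumpDual_coe_of_eq_exp _ hcont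
    hn.continuous (hn.gibbsWeight_coe hp0.le), weightedJump_add_eq hp0.ne']
  field_simp
  ring

theorem IsContinuousDensity.abs_potentialJumpError_le {M c ω : ℝ} (hn : IsContinuousDensity n ν)
    (hp : 1 ≤ p) (hβ : 0 ≤ β) (hc : 0 ≤ c) (hM : ∀ x, |n x| ≤ M)
    (hω : ∀ x y : ℝ, |y - x| ≤ c * Real.pi ^ (p - 1) → |n y - n x| ≤ ω) (u : ℝ) :
    |potentialJumpError p c β (fun t => n t) u| ≤
      2 * jumpRemainder Real.pi β (p * Real.pi ^ (p - 1) * M) M (c * Real.pi ^ (p - 1)) ω := by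
  have hN := continuous_comp_coe hn.continuous
  have hφ := (isProfile_pi_rpow_sub_one hp).const_mul hc
  have hV := hn.hasDerivAt_potentialLift hp
  have hV' := hasDerivAt_potentialLiftDeriv hp hN
  have hB₁ := abs_potentialLiftDeriv_le hp fun t => hM (t : ℝ)
  have hB₂ := abs_potentialLiftDeriv₂_le hp fun t => hM (t : ℝ)
  have hright := abs_weightedJumpError_le hφ hN hω (fun t => hM t) hV hV' hB₁ hB₂ hβ u
  have hleft := abs_weightedJumpError_le hφ (hN.comp continuous_neg)
    (fun x y hxy => hω _ _ (by rwa [← neg_sub', abs_neg])) (fun t => hM _)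
    (hasDerivAt_comp_neg hV) (fun z => (hasDerivAt_comp_neg hV' z).neg)
    (fun z => (abs_neg _).trans_le (hB₁ (-z)))
    (fun z => (abs_neg _).trans_le ((abs_neg _).trans_le (hB₂ (-z)))) hβ (-u)
  exact ((abs_add_le _ _).trans (add_le_add hright hleft)).trans_eq (two_mul _).symm

end GeneratorDualGibbs

/-! ### The size of the remainder -/

section Remainder

variable {a : ℝ}

theorem rpow_le_one_add {x : ℝ} (hx : 0 ≤ x) (ha : 0 ≤ a) (ha1 : a ≤ 1) : x ^ a ≤ 1 + x :=
  (Real.rpow_le_rpow hx (le_add_of_nonneg_left zero_le_one) ha).trans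
    (Real.rpow_le_self_of_one_le (le_add_of_nonneg_right hx) ha1)

theorem mul_rpow_le_one_add_mul_rpow {κ s t : ℝ} (hκ : 0 ≤ κ) (hs : 0 ≤ s) (hst : s ≤ t)
    (ha : 0 ≤ a) (ha1 : a ≤ 1) : (κ * s) ^ a ≤ (1 + κ) * t ^ a := by
  rw [Real.mul_rpow hκ hs]
  exact mul_le_mul (rpow_le_one_add hκ ha ha1) (Real.rpow_le_rpow hs hst ha)
    (Real.rpow_nonneg hs a) (add_nonneg zero_le_one hκ)

theorem le_one_add_mul_rpow {t R : ℝ} (ht : 0 < t) (htR : t ≤ R) (ha : 0 ≤ a) (ha1 : a ≤ 1) :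
    t ≤ (1 + R) * t ^ a := by
  calc t = t ^ (1 - a) * t ^ a := by rw [← Real.rpow_add ht, sub_add_cancel, Real.rpow_one]
    _ ≤ (1 + R) * t ^ a := mul_le_mul_of_nonneg_right
        ((rpow_le_one_add ht.le (sub_nonneg.2 ha1) (sub_le_self 1 ha)).trans (by linarith))
        (Real.rpow_nonneg ht.le a)

/-- The constant in the bound for `jumpRemainder`, for jumps of length at most `κ * β * α`, a
density with Hölder constant `A` and `α * β ^ 2 ≤ R`. -/
def remainderConst (κ A M B R : ℝ) : ℝ :=
  (1 + B) * κ * A * (1 + κ) + B * κ ^ 2 * (B * Real.exp (B * κ * R) + 1) * M * (1 + R)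

theorem remainderConst_pos {κ A M B R : ℝ} (hκ : 0 < κ) (hA : 0 ≤ A) (hM : 0 < M) (hB : 0 < B)
    (hR : 0 ≤ R) : 0 < remainderConst κ A M B R := by
  rw [remainderConst]
  positivity

theorem jumpRemainder_div_eq {κ α : ℝ} (hα : α ≠ 0) (β B M ω : ℝ) :
    jumpRemainder Real.pi β B M (κ * β * α) ω / (Real.pi * α) =
      (3 / Real.pi * β + B * β ^ 2) * κ * ω +
        B * κ ^ 2 * (B * β ^ 2 * Real.exp (B * κ * (α * β ^ 2)) + β) * M * (α * β ^ 2) := by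
  have hπ := Real.pi_pos.ne'
  rw [jumpRemainder, show β * B * (κ * β * α) = B * κ * (α * β ^ 2) by ring]
  field_simp

theorem jumpRemainder_div_le {κ A M B R α β : ℝ} (hκ : 0 ≤ κ) (hA : 0 ≤ A) (hM : 0 ≤ M)
    (hB : 0 ≤ B) (hα : 0 < α) (hβ : 1 ≤ β) (hR : α * β ^ 2 ≤ R) (ha : 0 ≤ a) (ha1 : a ≤ 1) :
    jumpRemainder Real.pi β B M (κ * β * α) (A * (κ * β * α) ^ a) / (Real.pi * α) ≤
      remainderConst κ A M B R * (α * β ^ 2) ^ a * β ^ 2 := by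
  have hβ0 : 0 < β := one_pos.trans_le hβ
  have hββ : β ≤ β ^ 2 := le_self_pow₀ hβ two_ne_zero
  have hrate : 3 / Real.pi * β + B * β ^ 2 ≤ (1 + B) * β ^ 2 := by
    have h3 : 3 / Real.pi ≤ 1 := (div_le_one Real.pi_pos).2 Real.pi_gt_three.le
    linarith [mul_le_mul h3 hββ hβ0.le zero_le_one]
  have hω : A * (κ * β * α) ^ a ≤ A * ((1 + κ) * (α * β ^ 2) ^ a) := by
    rw [mul_assoc κ, mul_comm β]
    have hle : α * β ≤ α * β ^ 2 := mul_le_mul_of_nonneg_left hββ hα.le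
    exact mul_le_mul_of_nonneg_left
      (mul_rpow_le_one_add_mul_rpow hκ (by positivity) hle ha ha1) hA
  have hexp : B * β ^ 2 * Real.exp (B * κ * (α * β ^ 2)) + β ≤
      (B * Real.exp (B * κ * R) + 1) * β ^ 2 := by
    have h : Real.exp (B * κ * (α * β ^ 2)) ≤ Real.exp (B * κ * R) := by gcongr
    linarith [mul_le_mul_of_nonneg_left h (by positivity : 0 ≤ B * β ^ 2)]
  have ht := le_one_add_mul_rpow (by positivity : 0 < α * β ^ 2) hR ha ha1
  rw [jumpRemainder_div_eq hα.ne']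
  calc _ ≤ (1 + B) * β ^ 2 * κ * (A * ((1 + κ) * (α * β ^ 2) ^ a)) +
        B * κ ^ 2 * ((B * Real.exp (B * κ * R) + 1) * β ^ 2) * M *
          ((1 + R) * (α * β ^ 2) ^ a) := by gcongr
    _ = remainderConst κ A M B R * (α * β ^ 2) ^ a * β ^ 2 := by
        rw [remainderConst]
        ring

theorem mul_sq_rpow_mul_sq_le {p α β : ℝ} (hα : 0 < α) (hα1 : α ≤ 1) (hβ : 1 ≤ β) (ha1 : a ≤ 1) :
    (α * β ^ 2) ^ a * β ^ 2 ≤ α ^ expo a p * β ^ 4 := by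
  have hexpo : expo a p ≤ a := by
    rw [expo]
    split_ifs
    exacts [min_le_left _ _, le_rfl]
  have hαa : α ^ a ≤ α ^ expo a p := Real.rpow_le_rpow_of_exponent_ge hα hα1 hexpo
  have hβa : (β ^ 2) ^ a ≤ β ^ 2 := Real.rpow_le_self_of_one_le (one_le_pow₀ hβ) ha1
  rw [Real.mul_rpow hα.le (sq_nonneg β)]
  calc α ^ a * (β ^ 2) ^ a * β ^ 2 ≤ α ^ expo a p * β ^ 2 * β ^ 2 := by gcongr
    _ = α ^ expo a p * β ^ 4 := by ring

end Remainder

/-! ### The adjoint of the generator -/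

section Adjoint

theorem sqrt_integral_sq_le {X : Type*} [MeasurableSpace X] {μ : Measure X}
    [IsProbabilityMeasure μ] {g : X → ℝ} {K : ℝ} (hK : 0 ≤ K) (hg : ∀ᵐ x ∂μ, |g x| ≤ K) :
    Real.sqrt (∫ x, g x ^ 2 ∂μ) ≤ K := by
  refine Real.sqrt_le_iff.2 ⟨hK, (le_abs_self _).trans ?_⟩
  have h := norm_integral_le_of_norm_le_const (μ := μ) (f := fun x => g x ^ 2) (C := K ^ 2) (by
    filter_upwards [hg] with x hx
    exact (norm_pow _ _).trans_le (pow_le_pow_left₀ (norm_nonneg _) hx 2))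
  rwa [probReal_univ, mul_one] at h

theorem inner_L2_eq_integral_mul {X : Type*} [MeasurableSpace X] {μ : Measure X}
    (f g : Lp ℝ 2 μ) : inner ℝ f g = ∫ x, f x * g x ∂μ := by
  simp only [L2.inner_def, RCLike.inner_apply, conj_trivial, mul_comm]

variable {p α β : ℝ} {n : Torus → ℝ} {ν : Measure Torus}

theorem coeFn_toL2 (f : C2) : toL2 p β ν f =ᵐ[gibbs p β ν] (f : C(Torus, ℝ)) :=
  ContinuousMap.coeFn_toLp (𝕜 := ℝ) (gibbs p β ν) (f : C(Torus, ℝ))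

theorem inner_toLp_toL2 {g : Torus → ℝ} (hg : MemLp g 2 (gibbs p β ν)) (f : C2) :
    inner ℝ (hg.toLp g) (toL2 p β ν f) = ∫ x, g x * (f : C(Torus, ℝ)) x ∂gibbs p β ν := by
  rw [inner_L2_eq_integral_mul]
  refine integral_congr_ae ?_
  filter_upwards [hg.coeFn_toLp, coeFn_toL2 f] with x hgx hfx
  rw [hgx, hfx]

theorem inner_oneL2_genL2 [IsProbabilityMeasure ν] (f : C2) :
    inner ℝ (oneL2 p β ν) (genL2 p α β ν f) =
      ∫ x, genFun p α β ν (f : C(Torus, ℝ)) x ∂gibbs p β ν := by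
  rw [inner_L2_eq_integral_mul]
  refine integral_congr_ae ?_
  filter_upwards [(memLp_genFun p α β ν (gibbs p β ν) f).coeFn_toLp,
    coeFn_toL2 (p := p) (β := β) (ν := ν) 1] with x hLf hone
  rw [oneL2, hone]
  exact (one_mul _).trans hLf

theorem exists_adjoint_oneL2_of_dual [IsProbabilityMeasure ν] {K : ℝ} (hβ : 0 ≤ β)
    {h : Torus → ℝ} (hh : Measurable h) (hK : ∀ x, |h x| ≤ K)
    (hdual : ∀ f : C2, ∫ x, h x * (f : C(Torus, ℝ)) x ∂gibbs p β ν =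
      ∫ x, genFun p α β ν (f : C(Torus, ℝ)) x ∂gibbs p β ν) :
    ∃ hd : oneL2 p β ν ∈ (generator p α ν hβ).adjoint.domain,
      Real.sqrt (∫ x, ((generator p α ν hβ).adjoint ⟨oneL2 p β ν, hd⟩ x) ^ 2 ∂gibbs p β ν) ≤ K := by
  have := isProbabilityMeasure_gibbs p ν hβ
  have hLp : MemLp h 2 (gibbs p β ν) := .of_bound hh.aestronglyMeasurable K (.of_forall hK)
  have hinner : ∀ x : (generator p α ν hβ).domain,
      inner ℝ (hLp.toLp h) (x : Lp ℝ 2 (gibbs p β ν)) =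
        inner ℝ (oneL2 p β ν) (generator p α ν hβ x) := by
    rintro ⟨_, f, rfl⟩
    rw [generator_apply, inner_toLp_toL2, inner_oneL2_genL2, hdual]
  have hd := LinearPMap.mem_adjoint_domain_of_exists _ ⟨_, hinner⟩
  refine ⟨hd, ?_⟩
  rw [LinearPMap.adjoint_apply_eq (dense_generator_domain p α ν hβ) ⟨oneL2 p β ν, hd⟩ hinner]
  refine sqrt_integral_sq_le ((abs_nonneg _).trans (hK 0)) ?_
  filter_upwards [hLp.coeFn_toLp] with x hx
  rw [hx]
  exact hK x

/-- A version of `L* 1`, for the adjoint `L*` of the generator in `L²` of the Gibbs measure, when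
`ν` has density `n`. -/
def adjointOne (p α β : ℝ) (n : Torus → ℝ) (ν : Measure Torus) (x : Torus) : ℝ :=
  (gibbsWeight p β ν x)⁻¹ * generatorDual p α β n (gibbsWeight p β ν) x

theorem integral_gibbs (g : Torus → ℝ) :
    ∫ x, g x ∂gibbs p β ν =
      (∫ x, gibbsWeight p β ν x ∂unif)⁻¹ * ∫ x, gibbsWeight p β ν x * g x ∂unif := by
  rw [gibbs, integral_tilted, ← integral_const_mul]
  simp only [gibbsWeight, smul_eq_mul, div_eq_inv_mul, mul_assoc]

theorem IsContinuousDensity.measurable_adjointOne (hn : IsContinuousDensity n ν) (hp : 1 ≤ p) :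
    Measurable (adjointOne p α β n ν) := by
  obtain ⟨E, hE⟩ := hn.exists_C2_eq_gibbsWeight (β := β) hp
  have hcont : Continuous (gibbsWeight p β ν) := hE ▸ (E : C(Torus, ℝ)).continuous
  exact hcont.measurable.inv.mul (hE ▸ measurable_generatorDual hn.continuous E)

theorem IsContinuousDensity.integral_adjointOne_mul (hn : IsContinuousDensity n ν) (hp : 1 ≤ p)
    (f : C2) :
    ∫ x, adjointOne p α β n ν x * (f : C(Torus, ℝ)) x ∂gibbs p β ν =
      ∫ x, genFun p α β ν (f : C(Torus, ℝ)) x ∂gibbs p β ν := by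
  obtain ⟨E, hE⟩ := hn.exists_C2_eq_gibbsWeight (β := β) hp
  have hdual := hn.integral_mul_genFun (p := p) (α := α) (β := β) E f
  rw [hE] at hdual
  rw [integral_gibbs, integral_gibbs, hdual]
  simp only [adjointOne, mul_assoc, mul_inv_cancel_left₀ (gibbsWeight_pos _).ne']

theorem IsContinuousDensity.abs_adjointOne_le {M A a : ℝ} (hn : IsContinuousDensity n ν)
    (hp : 1 ≤ p) (hα : 0 < α) (hβ : 0 ≤ β) (hM : ∀ x, |n x| ≤ M) (ha : 0 < a) (hA : 0 ≤ A)
    (hHolder : ∀ x y, |n y - n x| ≤ A * dist x y ^ a) (x : Torus) :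
    |adjointOne p α β n ν x| ≤
      jumpRemainder Real.pi β (p * Real.pi ^ (p - 1) * M) M
          (p / 2 * Real.pi ^ (p - 1) * β * α)
          (A * (p / 2 * Real.pi ^ (p - 1) * β * α) ^ a) / (Real.pi * α) := by
  induction x using QuotientAddGroup.induction_on with
  | H u =>
    have : 0 < p := one_pos.trans_le hp
    have herror := hn.abs_potentialJumpError_le (c := p / 2 * β * α) hp hβ (by positivity) hM
      (fun _ _ => abs_comp_coe_sub_le_of_holder ha hA hHolder) u
    have hadjoint := inv_mul_cancel_left₀ (gibbsWeight_pos (p := p) (β := β) (ν := ν) u).ne'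
      (potentialJumpError p (p / 2 * β * α) β (fun t => n t) u / (2 * Real.pi * α))
    rw [← hn.generatorDual_gibbsWeight_coe hp hα.ne'] at hadjoint
    have hlength : p / 2 * Real.pi ^ (p - 1) * β * α = p / 2 * β * α * Real.pi ^ (p - 1) := by
      ring
    rw [adjointOne, hadjoint, hlength, abs_div, abs_of_pos (by positivity : 0 < 2 * Real.pi * α),
      mul_assoc 2, ← div_div]
    gcongr
    linarith

end Adjoint

theorem mainTheorem5_general {p A R : ℝ} (hp : 1 ≤ p) (hA : 0 ≤ A) (hR : 0 ≤ R) :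
    ∃ C : ℝ, 0 < C ∧ ∀ a : ℝ, 0 < a → a ≤ 1 →
      ∀ (ν : Measure Torus) [IsProbabilityMeasure ν], HasHolderDensity ν a A →
      ∀ (α β : ℝ) (_ : 0 < α) (hβ : 1 ≤ β) (_ : α * β ^ 2 ≤ R),
        ∃ h : oneL2 p β ν ∈ (generator p α ν (zero_le_one.trans hβ)).adjoint.domain,
          Real.sqrt (∫ x, ((generator p α ν (zero_le_one.trans hβ)).adjoint
            ⟨oneL2 p β ν, h⟩ x) ^ 2 ∂gibbs p β ν) ≤ C * (α * β ^ 2) ^ a * β ^ 2 := by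
  have : 0 < p := one_pos.trans_le hp
  have hκ : 0 < p / 2 * Real.pi ^ (p - 1) := by positivity
  have hM : 0 < 1 + A * Real.pi := by positivity
  have hB : 0 < p * Real.pi ^ (p - 1) * (1 + A * Real.pi) := by positivity
  refine ⟨remainderConst (p / 2 * Real.pi ^ (p - 1)) A (1 + A * Real.pi)
    (p * Real.pi ^ (p - 1) * (1 + A * Real.pi)) R, remainderConst_pos hκ hA hM hB hR,
    fun a ha ha1 ν _ hν α β hα hβ hαβ => ?_⟩
  obtain ⟨n, hn, hHolder⟩ := hν.exists_isContinuousDensity ha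
  have hbound := hn.abs_adjointOne_le hp hα (zero_le_one.trans hβ)
    (hn.abs_le_of_holder ha ha1 hA hHolder) ha hA hHolder
  exact exists_adjoint_oneL2_of_dual _ (hn.measurable_adjointOne hp)
    (fun x => (hbound x).trans
      (jumpRemainder_div_le hκ.le hA hM.le hB.le hα hβ hαβ ha.le ha1))
    (hn.integral_adjointOne_mul hp)

end

end CircleMeans

theorem mainTheorem5 :
    ∀ p : ℝ, 1 ≤ p → ∃ σ : ℝ, 0 < σ ∧ σ < 1 / 2 ∧
      ∀ A : ℝ, 0 < A → ∃ C : ℝ, 0 < C ∧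
        ∀ a : ℝ, 0 < a → a ≤ 1 →
        ∀ (ν : MeasureTheory.Measure CircleMeans.Torus) [MeasureTheory.IsProbabilityMeasure ν],
        CircleMeans.HasHolderDensity ν a A →
        ∀ (α β : ℝ) (_ : 0 < α) (hβ : 1 < β) (_ : α * β ^ 2 < σ),
          ∃ h : CircleMeans.oneL2 p β ν ∈
              (CircleMeans.generator p α ν (zero_le_one.trans hβ.le)).adjoint.domain,
            Real.sqrt (∫ x, ((CircleMeans.generator p α ν (zero_le_one.trans hβ.le)).adjoint
                ⟨CircleMeans.oneL2 p β ν, h⟩ x) ^ 2 ∂(CircleMeans.gibbs p β ν))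
              ≤ C * α ^ CircleMeans.expo a p * β ^ 4 := by
  intro p hp
  refine ⟨1 / 4, by norm_num, by norm_num, fun A hA => ?_⟩
  obtain ⟨C, hC, hbound⟩ := CircleMeans.mainTheorem5_general hp hA.le zero_le_one
  refine ⟨C, hC, fun a ha ha1 ν _ hν α β hα hβ hαβ => ?_⟩
  obtain ⟨h, hle⟩ := hbound a ha ha1 ν hν α β hα hβ.le (by linarith)
  refine ⟨h, hle.trans ?_⟩
  have hα1 : α ≤ 1 := by
    linarith [le_mul_of_one_le_right hα.le (one_le_pow₀ (n := 2) hβ.le)]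
  rw [mul_assoc, mul_assoc]
  exact mul_le_mul_of_nonneg_left (CircleMeans.mul_sq_rpow_mul_sq_le hα hα1 hβ.le ha1) hC.le
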